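/- **Conventions.** Let $\lambda$ be a regular cardinal. A poset is $\lambda$-directed if each of its subsets with fewer than $\lambda$ elements has an upper bound. An object $M$ is $\lambda$-presentable if $\operatorname{Hom}(M,-)$ preserves $\lambda$-directed colimits. A (locally small) category is $\lambda$-accessible if it has all $\lambda$-directed colimits and a set $\mathcal A$ of $\lambda$-presentable objects such that every object is a $\lambda$-directed colimit of objects of $\mathcal A$. A functor is $\lambda$-accessible if its source and target are $\lambda$-accessible and it preserves $\lambda$-directed colimits; a category or functor is accessible if it is $\lambda$-accessible for some regular $\lambda$. For regular $\lambda<\mu$ write $\lambda\vartriangleleft\mu$ ("$\mu$ is sharply greater than $\lambda$") if for every set $X$ with $|X|<\mu$ the poset of subsets of $X$ of cardinality $<\lambda$ has a cofinal subset of cardinality $<\mu$; write $\lambda\trianglelefteq\mu$ if $\lambda\vartriangleleft\mu$ or $\lambda=\mu$. For a cardinal $\beta$ let $\gamma_{\beta,\lambda}$ be the least $\gamma\ge\beta$ with $\lambda\trianglelefteq\gamma$, and let $\mu_{\beta,\lambda}=(\gamma_{\beta,\lambda}^{<\gamma_{\beta,\lambda}})^+$. If $\mathcal K$ is $\lambda$-accessible,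 let $\mu_{\mathcal K,\lambda}=\mu_{\beta,\lambda}$, where $\beta$ is the number of morphisms of a full subcategory on a set of representatives of the isomorphism classes of $\lambda$-presentable objects. For an accessible category $\mathcal K$ put $\mu_{\mathcal K}=\mu_{\mathcal K,\lambda}$ with $\lambda$ least such that $\mathcal K$ is $\lambda$-accessible; $\mathcal K$ is *below* $\delta$ if $\mu_{\mathcal K}<\delta$. For an accessible functor $F:\mathcal K\to\mathcal L$, let $\lambda$ be least such that $F$ is $\lambda$-accessible and let $\mu_F$ be the least regular $\mu\ge\mu_{\mathcal L,\lambda}$ such that $F$ preserves $\mu$-presentable objects; $F$ is *below* $\delta$ if $\mu_F<\delta$. The powerful image of $F$ is the full subcategory of $\mathcal L$ on the objects $M$ that admit a monomorphism $M\to FA$ for some $A\in\mathcal K$. A diagram indexed by a poset $I$ is $\nu$-small if $|I|<\nu$. A concretely $\lambda$-accessible category is a $\lambda$-accessible category $\mathcal K$ with a faithful $\lambda$-accessible functor $U:\mathcal K\to\mathbf{Set}$ that preserves $\lambda$-presentable objects. For $M\in\mathcal K$ and pairs $(f_i,a_i)$ with $f_i:M\to N_i$ and $a_i\in UN_i$ ($i=1,2$),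 call $(f_1,a_1)$ and $(f_2,a_2)$ equivalent if there are $g_i:N_i\to N$ with $g_1f_1=g_2f_2$ and $U(g_1)(a_1)=U(g_2)(a_2)$. The category $\mathcal K$ is $(<\kappa,\theta)$-tame if for every $\theta^+$-presentable $M$ and all pairs $(f_1,a_1)$, $(f_2,a_2)$ over $M$: if $(f_1\chi,a_1)$ and $(f_2\chi,a_2)$ are equivalent for every $\chi:X\to M$ with $X$ $\kappa$-presentable, then $(f_1,a_1)$ and $(f_2,a_2)$ are equivalent. **Theorem.** Let $\delta\le\kappa$ be inaccessible cardinals and $\theta$ a cardinal such that $\kappa\trianglelefteq\theta^+$. Suppose that every accessible functor $F:\mathcal A\to\mathcal B$ below $\delta$ whose source $\mathcal A$ is below $\delta$ has powerful image closed in $\mathcal B$ under $\theta^+$-small $\kappa$-directed colimits. Then for every $\lambda<\delta$, every concretely $\lambda$-accessible category $\mathcal K$ that is below $\delta$ is $(<\kappa,\theta)$-tame. -/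

import Mathlib

open CategoryTheory Limits

universe w

noncomputable section

namespace AccTame

/-! Sets are the elements of `Type w`; a (locally small, possibly large) category has its objects in
`Type (w + 1)` and its morphisms in `Type w`. -/

section Cardinals

/-- `lam` is sharply smaller than `mu`, for regular cardinals `lam < mu`: for every set `X` with
fewer than `mu` elements, the poset of subsets of `X` with fewer than `lam` elements has a cofinal
subset with fewer than `mu` elements. -/
structure SharplyLT (lam mu : Cardinal.{w}) : Prop where
  regular_left : lam.IsRegular
  regular_right : mu.IsRegular
  lt : lam < mu
  exists_cofinal : ∀ X : Type w, Cardinal.mk X < mu →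
    ∃ Y : Set (Set X), Cardinal.mk Y < mu ∧ (∀ s ∈ Y, Cardinal.mk s < lam) ∧
      ∀ s : Set X, Cardinal.mk s < lam → ∃ t ∈ Y, s ⊆ t

/-- `lam` is sharply smaller than or equal to `mu` (both regular). -/
def SharplyLE (lam mu : Cardinal.{w}) : Prop :=
  (lam.IsRegular ∧ lam = mu) ∨ SharplyLT lam mu

/-- The least cardinal `γ ≥ beta` to which `lam` is sharply smaller or equal. -/
def gammaCard (beta lam : Cardinal.{w}) : Cardinal.{w} :=
  sInf {γ | beta ≤ γ ∧ SharplyLE lam γ}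

/-- There is such a `γ`, so the infimum is a minimum. -/
theorem gammaCard_mem (beta : Cardinal.{w}) {lam : Cardinal.{w}} (h : lam.IsRegular) :
    beta ≤ gammaCard beta lam ∧ SharplyLE lam (gammaCard beta lam) := by
  suffices hne : {γ : Cardinal.{w} | beta ≤ γ ∧ SharplyLE lam γ}.Nonempty from csInf_mem hne
  have h0 := h.aleph0_le
  set m := max beta lam with hm
  have hm0 : Cardinal.aleph0 ≤ m := h0.trans (le_max_right _ _)
  have hmm : m ≤ m ^ lam := Cardinal.self_le_power m (Cardinal.one_le_aleph0.trans h0)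
  refine ⟨Order.succ (m ^ lam), ((le_max_left _ _).trans hmm).trans (Order.le_succ _), Or.inr
    ⟨h, Cardinal.isRegular_succ (hm0.trans hmm),
      ((le_max_right _ _).trans hmm).trans_lt (Order.lt_succ _), fun X hX ↦ ?_⟩⟩
  refine ⟨{s | Cardinal.mk s < lam}, ?_, fun s hs ↦ hs, fun s hs ↦ ⟨s, hs, subset_rfl⟩⟩
  rw [Order.lt_succ_iff] at hX ⊢
  calc Cardinal.mk {s : Set X | Cardinal.mk s < lam}
      ≤ Cardinal.mk {s : Set X // Cardinal.mk s ≤ lam} :=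
        Cardinal.mk_le_of_injective (f := fun s ↦ ⟨s.1, le_of_lt s.2⟩)
          (fun s t hst ↦ Subtype.ext (by simpa using hst))
    _ ≤ max (Cardinal.mk X) Cardinal.aleph0 ^ lam := Cardinal.mk_bounded_set_le X lam
    _ ≤ (m ^ lam) ^ lam :=
        Cardinal.power_le_power_right (max_le hX (hm0.trans hmm))
    _ = m ^ lam := by rw [← Cardinal.power_mul, Cardinal.mul_eq_self h0]

/-- `μ_{β,λ} = (γ^{<γ})⁺` for `γ = γ_{β,λ}`. -/
def muCard (beta lam : Cardinal.{w}) : Cardinal.{w} :=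
  Order.succ (Cardinal.powerlt (gammaCard beta lam) (gammaCard beta lam))

end Cardinals

section Categories

variable {C : Type (w + 1)} [Category.{w} C] {D : Type (w + 1)} [Category.{w} D]

/-- `X` is a `lam`-presentable object (`lam` a regular cardinal). -/
def Presentable (lam : Cardinal.{w}) (X : C) : Prop :=
  ∃ _ : Fact lam.IsRegular, IsCardinalPresentable X lam

variable (C) in
/-- `C` is a `lam`-accessible category (`lam` a regular cardinal). -/
def AccessibleCat (lam : Cardinal.{w}) : Prop :=
  ∃ _ : Fact lam.IsRegular, IsCardinalAccessibleCategory C lam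

/-- `F` is a `lam`-accessible functor: its source and its target are `lam`-accessible categories
and it preserves `lam`-filtered (equivalently, `lam`-directed) colimits. -/
def AccessibleFunctor (F : C ⥤ D) (lam : Cardinal.{w}) : Prop :=
  ∃ _ : Fact lam.IsRegular, IsCardinalAccessibleCategory C lam ∧
    IsCardinalAccessibleCategory D lam ∧ F.IsCardinalAccessible lam

/-- `F` preserves `mu`-presentable objects. -/
def PreservesPresentable (F : C ⥤ D) (mu : Cardinal.{w}) : Prop :=
  ∀ X : C, Presentable mu X → Presentable mu (F.obj X)

variable (C) in
/-- A full subcategory of `C` on a set of representatives of the isomorphism classes of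
`lam`-presentable objects. -/
abbrev Pres (lam : Cardinal.{w}) : Type (w + 1) :=
  Skeleton (ObjectProperty.FullSubcategory (fun X : C ↦ Presentable lam X))

variable (C) in
/-- The cardinality (number of morphisms) of `Pres C lam`, as a cardinal of the universe of sets;
see `lift_presCard`. -/
def presCard (lam : Cardinal.{w}) : Cardinal.{w} :=
  sInf {β | Cardinal.mk (Arrow (Pres C lam)) = Cardinal.lift.{w + 1} β}

/-- If `C` is `lam`-accessible, `Pres C lam` is indeed small and `presCard` is its cardinality. -/
theorem lift_presCard {lam : Cardinal.{w}} (h : AccessibleCat C lam) :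
    Cardinal.lift.{w + 1} (presCard C lam) = Cardinal.mk (Arrow (Pres C lam)) := by
  obtain ⟨h1, h2⟩ := h
  have hp : (fun X : C ↦ Presentable lam X) = isCardinalPresentable C lam := by
    funext X
    exact propext ⟨fun h ↦ h.2, fun h ↦ ⟨h1, h⟩⟩
  have : EssentiallySmall.{w} (ObjectProperty.FullSubcategory (fun X : C ↦ Presentable lam X)) := by
    rw [hp]
    infer_instance
  have : Small.{w} (Arrow (Pres C lam)) := by
    let f : Arrow (Pres C lam) → Σ p : Pres C lam × Pres C lam, (p.1 ⟶ p.2) :=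
      fun a ↦ ⟨(a.left, a.right), a.hom⟩
    refine small_of_injective (f := f) ?_
    rintro ⟨a, b, g⟩ ⟨a', b', g'⟩ h
    simp only [f, Sigma.mk.injEq, Prod.mk.injEq] at h
    obtain ⟨⟨rfl, rfl⟩, h⟩ := h
    obtain rfl := eq_of_heq h
    rfl
  have hne : {β : Cardinal.{w} | Cardinal.mk (Arrow (Pres C lam)) =
      Cardinal.lift.{w + 1} β}.Nonempty :=
    ⟨Cardinal.mk (Shrink.{w} (Arrow (Pres C lam))), 
      (Cardinal.lift_mk_shrink''.{w + 1, w} (Arrow (Pres C lam))).symm⟩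
  exact (csInf_mem hne).symm

variable (C) in
/-- The parameter `μ_{C,λ}` of a `lam`-accessible category `C`. -/
def muCat (lam : Cardinal.{w}) : Cardinal.{w} :=
  muCard (presCard C lam) lam

variable (C) in
/-- The accessible category `C` is below `delta`: `μ_C < delta`, where `μ_C = μ_{C,λ}` for the least
`lam` such that `C` is `lam`-accessible. -/
def CategoryBelow (delta : Cardinal.{w}) : Prop :=
  ∃ lam, IsLeast {l : Cardinal.{w} | AccessibleCat C l} lam ∧ muCat C lam < delta

/-- `mu` is the parameter `μ_F` of the accessible functor `F`: if `lam` is least such that `F` is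
`lam`-accessible, then `mu` is the least regular cardinal `≥ μ_{D,λ}` such that `F` preserves
`mu`-presentable objects. -/
def IsMuFunctor (F : C ⥤ D) (mu : Cardinal.{w}) : Prop :=
  ∃ lam, IsLeast {l : Cardinal.{w} | AccessibleFunctor F l} lam ∧
    IsLeast {m : Cardinal.{w} | m.IsRegular ∧ muCat D lam ≤ m ∧ PreservesPresentable F m} mu

/-- The accessible functor `F` is below `delta`: `μ_F < delta`. -/
def FunctorBelow (F : C ⥤ D) (delta : Cardinal.{w}) : Prop :=
  ∃ mu, IsMuFunctor F mu ∧ mu < delta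

/-- The powerful image of `F`: the objects with a monomorphism to some `F.obj A`. -/
def powerfulImage (F : C ⥤ D) : ObjectProperty D :=
  fun M ↦ ∃ (A : C) (m : M ⟶ F.obj A), Mono m

/-- The poset `I` is `kappa`-directed. -/
def DirectedPoset (I : Type w) [PartialOrder I] (kappa : Cardinal.{w}) : Prop :=
  ∀ J : Set I, Cardinal.mk J < kappa → ∃ i : I, ∀ j ∈ J, j ≤ i

/-- The full subcategory of `D` on `P` is closed in `D` under `nu`-small `kappa`-directed
colimits. -/
def ClosedUnderSmallDirectedColimits (P : ObjectProperty D) (nu kappa : Cardinal.{w}) : Prop :=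
  ∀ (I : Type w) [PartialOrder I], DirectedPoset I kappa → Cardinal.mk I < nu →
    ∀ (G : I ⥤ D), (∀ i, P (G.obj i)) → ∀ c : Cocone G, Nonempty (IsColimit c) → P c.pt

end Categories

section Types

variable {K : Type (w + 1)} [Category.{w} K]

/-- `(K, U)` is a concretely `lam`-accessible category. -/
structure ConcretelyAccessible (U : K ⥤ Type w) (lam : Cardinal.{w}) : Prop where
  accessibleCat : AccessibleCat K lam
  faithful : U.Faithful
  accessibleFunctor : AccessibleFunctor U lam
  preservesPresentable : PreservesPresentable U lam

/-- The pairs `(f₁, a₁)` and `(f₂, a₂)` over `M` are equivalent (represent the same Galois type): the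
pointed span extends to a commutative square whose two new sides identify `a₁` and `a₂`. -/
def TypeEquiv (U : K ⥤ Type w) {M N₁ N₂ : K} (f₁ : M ⟶ N₁) (a₁ : U.obj N₁)
    (f₂ : M ⟶ N₂) (a₂ : U.obj N₂) : Prop :=
  ∃ (N : K) (g₁ : N₁ ⟶ N) (g₂ : N₂ ⟶ N), f₁ ≫ g₁ = f₂ ≫ g₂ ∧ U.map g₁ a₁ = U.map g₂ a₂

/-- `(K, U)` is `(<kappa, theta)`-tame. -/
def Tame (U : K ⥤ Type w) (kappa theta : Cardinal.{w}) : Prop :=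
  ∀ M : K, Presentable (Order.succ theta) M →
    ∀ (N₁ N₂ : K) (f₁ : M ⟶ N₁) (a₁ : U.obj N₁) (f₂ : M ⟶ N₂) (a₂ : U.obj N₂),
      (∀ (X : K) (χ : X ⟶ M), Presentable kappa X → TypeEquiv U (χ ≫ f₁) a₁ (χ ≫ f₂) a₂) →
        TypeEquiv U f₁ a₁ f₂ a₂

end Types

end AccTame

end

-- Tameness is turned into a closure property of one powerful image. The category `PointedSpan U`
-- consists of data `(f₁, a₁)`, `(f₂, a₂)` over a common source, and `AmalgamatedSpan U` consists of
-- such a span with a morphism to the span of identities of a pointed object. Such a morphism is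
-- exactly a witness of equivalence. Composing with it makes monomorphisms irrelevant, so the
-- powerful image of the forgetful functor is the class of spans whose two pairs are equivalent
-- (`powerfulImage_fst_mk_iff`).
--
-- Since `kappa` is inaccessible, `lam` is sharply smaller than `kappa`; hence a
-- `theta⁺`-presentable `M` is a retract of a `theta⁺`-small `kappa`-directed colimit `Y` of
-- `kappa`-presentable objects (`exists_retract_of_sharplyLT_of_sharplyLE`). Pulling the span back
-- along `Y ⟶ M` gives a colimit of spans over these objects with fixed targets
-- (`isColimitSpanCocone`). Each of them lies in the powerful image by the assumption on small
-- subobjects of the type, hence so does the colimit, and the section `M ⟶ Y` carries the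
-- equivalence back to `M`.
--
-- It remains to see that the forgetful functor and its source are below `delta`
-- (`closedUnderSmallDirectedColimits_fst`). All categories involved are iterated comma categories
-- whose left functor preserves `lam`-presentable objects; their `lam`-presentable objects are those
-- with `lam`-presentable components (`presentableComma_eq`), so they are few if those of `K` are.
-- The parameters `μ` refer to least indices of accessibility, which are hard to determine. They are
-- therefore replaced by `EssentiallyBelow`, a bound that can be moved between indices below an
-- inaccessible `delta`.

universe v u u' v₁ v₂ u₁ u₂ u₃

noncomputable section

namespace AccTame

/-! ### Sharp inequality and cardinal bounds below an inaccessible cardinal. -/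

section Cardinals

variable {delta : Cardinal.{w}}

theorem power_lt_of_isInaccessible (hd : delta.IsInaccessible) {a b : Cardinal.{w}}
    (ha : a < delta) (hb : b < delta) : a ^ b < delta := by
  have h0 := hd.aleph0_lt
  set m := max (max a b) Cardinal.aleph0 with hm
  have hm0 : Cardinal.aleph0 ≤ m := le_max_right _ _
  have hmd : m < delta := max_lt (max_lt ha hb) h0
  calc a ^ b ≤ m ^ b := Cardinal.power_le_power_right ((le_max_left _ _).trans (le_max_left _ _))
    _ ≤ m ^ m := Cardinal.power_le_power_left (Cardinal.aleph0_pos.trans_le hm0).ne'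
        ((le_max_right _ _).trans (le_max_left _ _))
    _ = 2 ^ m := Cardinal.power_self_eq hm0
    _ < delta := hd.isStrongPrelimit hmd

/-- As `(m ^ lam) ^ lam = m ^ lam`, a set of size at most `m ^ lam` has at most `m ^ lam` subsets of
size less than `lam`, and all of them can serve as the cofinal family. -/
theorem sharplyLT_succ_power {lam m : Cardinal.{w}} (h : lam.IsRegular) (hm : lam ≤ m) :
    SharplyLT lam (Order.succ (m ^ lam)) := by
  have h0 := h.aleph0_le
  have hm0 : Cardinal.aleph0 ≤ m := h0.trans hm
  have hmm : m ≤ m ^ lam := Cardinal.self_le_power m (Cardinal.one_le_aleph0.trans h0)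
  refine ⟨h, Cardinal.isRegular_succ (hm0.trans hmm), (hm.trans hmm).trans_lt (Order.lt_succ _),
    fun X hX ↦ ⟨{s | Cardinal.mk s < lam}, ?_, fun s hs ↦ hs, fun s hs ↦ ⟨s, hs, subset_rfl⟩⟩⟩
  rw [Order.lt_succ_iff] at hX ⊢
  calc Cardinal.mk {s : Set X | Cardinal.mk s < lam}
      ≤ Cardinal.mk {s : Set X // Cardinal.mk s ≤ lam} :=
        Cardinal.mk_le_of_injective (f := fun s ↦ ⟨s.1, le_of_lt s.2⟩)
          (fun s t hst ↦ Subtype.ext (by simpa using hst))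
    _ ≤ max (Cardinal.mk X) Cardinal.aleph0 ^ lam := Cardinal.mk_bounded_set_le X lam
    _ ≤ (m ^ lam) ^ lam :=
        Cardinal.power_le_power_right (max_le hX (hm0.trans hmm))
    _ = m ^ lam := by rw [← Cardinal.power_mul, Cardinal.mul_eq_self h0]

theorem gammaCard_lt (hd : delta.IsInaccessible) {beta lam : Cardinal.{w}} (hb : beta < delta)
    (hl : lam < delta) (h : lam.IsRegular) : gammaCard beta lam < delta := by
  have hs := sharplyLT_succ_power h (le_max_right beta lam)
  refine (csInf_le' (show Order.succ (max beta lam ^ lam) ∈ {γ | beta ≤ γ ∧ SharplyLE lam γ} from ⟨?_, Or.inr hs⟩)).trans_lt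
    (hd.isSuccLimit.succ_lt (power_lt_of_isInaccessible hd (max_lt hb hl) hl))
  exact ((le_max_left _ _).trans (Cardinal.self_le_power _
    (Cardinal.one_le_aleph0.trans h.aleph0_le))).trans (Order.le_succ _)

theorem SharplyLE.regular_right {lam mu : Cardinal.{w}} (h : SharplyLE lam mu) : mu.IsRegular := by
  obtain ⟨h, rfl⟩ | h := h
  exacts [h, h.regular_right]

theorem SharplyLE.le {lam mu : Cardinal.{w}} (h : SharplyLE lam mu) : lam ≤ mu := by
  obtain ⟨_, rfl⟩ | h := h
  exacts [le_rfl, h.lt.le]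

theorem muCard_lt (hd : delta.IsInaccessible) {beta lam : Cardinal.{w}} (hb : beta < delta)
    (hl : lam < delta) (h : lam.IsRegular) : muCard beta lam < delta := by
  have hg := gammaCard_lt hd hb hl h
  refine hd.isSuccLimit.succ_lt (lt_of_le_of_lt ?_ (power_lt_of_isInaccessible hd hg hg))
  exact Cardinal.powerlt_le.2 fun x hx ↦ Cardinal.power_le_power_left
    ((zero_le (a := x)).trans_lt hx).ne' hx.le

/-- Since `γ = γ ^ 1 ≤ γ^{<γ}`, a bound on `μ` also bounds the number of morphisms between
presentable objects. -/
theorem lt_muCard (beta : Cardinal.{w}) {lam : Cardinal.{w}} (h : lam.IsRegular) :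
    beta < muCard beta lam := by
  have hg := gammaCard_mem beta h
  refine hg.1.trans_lt (Order.lt_succ_iff.2 ?_)
  simpa using Cardinal.le_powerlt (gammaCard beta lam)
    (Cardinal.one_lt_aleph0.trans_le hg.2.regular_right.aleph0_le)

/-- By the strong limit property even the full power set of a set smaller than `kappa` is smaller
than `kappa`. -/
theorem sharplyLT_of_isInaccessible {lam kappa : Cardinal.{w}} (h : lam.IsRegular)
    (hk : kappa.IsInaccessible) (hlt : lam < kappa) : SharplyLT lam kappa := by
  refine ⟨h, hk.isRegular, hlt, fun X hX ↦ ⟨{s | Cardinal.mk s < lam}, ?_, fun s hs ↦ hs,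
    fun s hs ↦ ⟨s, hs, subset_rfl⟩⟩⟩
  refine (Cardinal.mk_set_le _).trans_lt ?_
  rw [Cardinal.mk_set]
  exact hk.isStrongPrelimit hX

theorem SharplyLT.exists_directed_set {lam mu : Cardinal.{w}} [Fact lam.IsRegular]
    [Fact mu.IsRegular] (h : SharplyLT lam mu) {X : Type w} [PartialOrder X]
    [IsCardinalFiltered X lam] (A : Set X) (hA : HasCardinalLT A mu) :
    ∃ B : Set X, A ⊆ B ∧ IsCardinalFiltered B lam ∧ HasCardinalLT B mu := by
  refine Cardinal.SharplyLT.exists_isCardinalFiltered_set_of_exists_cofinal h.lt ?_ A hA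
  intro X hX
  obtain ⟨Y, hY, hY', hc⟩ := h.exists_cofinal X (by rwa [← hasCardinalLT_iff_cardinal_mk_lt])
  refine ⟨{s | s.1 ∈ Y}, ?_, ?_⟩
  · rw [← hasCardinalLT_iff_cardinal_mk_lt] at hY
    exact hY.of_injective (fun s ↦ ⟨s.1.1, s.2⟩) fun s t hst ↦ by
      ext1; ext1; simpa using hst
  · rintro ⟨s, hs⟩
    obtain ⟨t, ht, hst⟩ := hc s (by rwa [← hasCardinalLT_iff_cardinal_mk_lt])
    exact ⟨⟨t, by rw [hasCardinalLT_iff_cardinal_mk_lt]; exact hY' t ht⟩, ht, hst⟩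

theorem isCardinalFiltered_iff_directedPoset (I : Type w) [PartialOrder I] (kappa : Cardinal.{w})
    [Fact kappa.IsRegular] : IsCardinalFiltered I kappa ↔ DirectedPoset I kappa := by
  constructor
  · intro _ J hJ
    rw [← hasCardinalLT_iff_cardinal_mk_lt] at hJ
    exact ⟨IsCardinalFiltered.max Subtype.val hJ,
      fun j hj ↦ leOfHom (IsCardinalFiltered.toMax Subtype.val hJ ⟨j, hj⟩)⟩
  · intro h
    refine isCardinalFiltered_preorder _ _ fun K s hK ↦ ?_
    obtain ⟨i, hi⟩ := h (Set.range s) (Cardinal.mk_range_le.trans_lt hK)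
    exact ⟨i, fun k ↦ hi _ ⟨k, rfl⟩⟩

theorem hasCardinalLT_arrow_of_preorder {I : Type w} [Preorder I] {mu : Cardinal.{w}}
    (hmu : Cardinal.aleph0 ≤ mu) (hI : HasCardinalLT I mu) : HasCardinalLT (Arrow I) mu := by
  refine (hasCardinalLT_prod hmu hI hI).of_injective (fun a ↦ (a.left, a.right)) ?_
  rintro ⟨a, b, f⟩ ⟨a', b', f'⟩ h
  simp only [Prod.mk.injEq] at h
  obtain ⟨rfl, rfl⟩ := h
  obtain rfl := Subsingleton.elim f f'
  rfl

end Cardinals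

/-! ### Directed colimits as more highly directed colimits of small ones. -/

section Decomposition

variable {C : Type u} [Category.{v} C]

/-- The objects that are colimits of `kappa`-directed diagrams, indexed by a poset with fewer than
`mu` elements, of objects in `P`. -/
def smallDirectedColimits (P : ObjectProperty C) (kappa mu : Cardinal.{w})
    [Fact kappa.IsRegular] : ObjectProperty C :=
  fun X ↦ ∃ (I : Type w) (_ : PartialOrder I), IsCardinalFiltered I kappa ∧ HasCardinalLT I mu ∧
    P.colimitsOfShape I X

variable {P : ObjectProperty C} {kappa mu : Cardinal.{w}} [Fact kappa.IsRegular]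

theorem smallDirectedColimits_le_isCardinalPresentable [Fact mu.IsRegular] [LocallySmall.{w} C]
    (hP : P ≤ isCardinalPresentable C kappa) (h : kappa ≤ mu) :
    smallDirectedColimits P kappa mu ≤ isCardinalPresentable C mu := by
  rintro X ⟨I, _, _, hI, ⟨p⟩⟩
  exact p.isCardinalPresentable hP mu h
    (hasCardinalLT_arrow_of_preorder (Fact.out : mu.IsRegular).aleph0_le hI)

section

variable {I : Type w} [PartialOrder I] (G : I ⥤ C)

/-- The restriction of a diagram indexed by a poset to a subset. -/
abbrev restrictDiagram (B : Set I) : B ⥤ C := (Subtype.mono_coe (· ∈ B)).functor ⋙ G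

variable (kappa mu) in
/-- The subsets of `I` with fewer than `mu` elements that are `kappa`-directed. -/
abbrev DirectedSubset (I : Type w) [PartialOrder I] : Type w :=
  {B : Set I // IsCardinalFiltered B kappa ∧ HasCardinalLT B mu}

instance (B : DirectedSubset kappa mu I) : IsCardinalFiltered B.1 kappa := B.2.1

variable [HasCardinalFilteredColimits.{w} C kappa]

instance (B : DirectedSubset kappa mu I) : HasColimit (restrictDiagram G B.1) :=
  (HasCardinalFilteredColimits.hasColimitsOfShape (κ := kappa) C B.1).has_colimit _

theorem DirectedSubset.mem_of_hom {B B' : DirectedSubset kappa mu I} (f : B ⟶ B') {i : I}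
    (hi : i ∈ B.1) : i ∈ B'.1 :=
  (leOfHom f : B.1 ⊆ B'.1) hi

/-- The colimit of the restriction of a diagram to a small directed subset of its index. -/
def partialColimit (B : DirectedSubset kappa mu I) : C := colimit (restrictDiagram G B.1)

variable {G} in
/-- The inclusion of a member of a diagram into a partial colimit. -/
def partialι (B : DirectedSubset kappa mu I) (i : I) (hi : i ∈ B.1) :
    G.obj i ⟶ partialColimit G B :=
  colimit.ι (restrictDiagram G B.1) ⟨i, hi⟩

variable {G} in
/-- The morphism out of a partial colimit defined by a compatible family. -/
def partialDesc (B : DirectedSubset kappa mu I) {X : C} (f : ∀ i ∈ B.1, G.obj i ⟶ X)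
    (hf : ∀ i hi j hj (h : i ⟶ j), G.map h ≫ f j hj = f i hi) :
    partialColimit G B ⟶ X :=
  colimit.desc (restrictDiagram G B.1)
    { pt := X
      ι :=
        { app i := f i.1 i.2
          naturality i j g := (hf i.1 i.2 j.1 j.2 (homOfLE (leOfHom g))).trans
            (Category.comp_id _).symm } }

@[simp]
theorem partialι_partialDesc (B : DirectedSubset kappa mu I) {X : C} (f : ∀ i ∈ B.1, G.obj i ⟶ X)
    (hf : ∀ i hi j hj (h : i ⟶ j), G.map h ≫ f j hj = f i hi) (i : I) (hi : i ∈ B.1) :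
    partialι B i hi ≫ partialDesc B f hf = f i hi :=
  colimit.ι_desc _ _

@[simp]
theorem map_partialι (B : DirectedSubset kappa mu I) {i j : I} (hi : i ∈ B.1) (hj : j ∈ B.1)
    (h : i ⟶ j) : G.map h ≫ partialι B j hj = partialι B i hi :=
  colimit.w (restrictDiagram G B.1) (j := ⟨j, hj⟩) (j' := ⟨i, hi⟩)
    (homOfLE (Subtype.mk_le_mk.2 (leOfHom h)))

variable {G} in
theorem partial_hom_ext (B : DirectedSubset kappa mu I) {X : C}
    {f g : partialColimit G B ⟶ X}
    (h : ∀ i hi, partialι B i hi ≫ f = partialι B i hi ≫ g) : f = g :=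
  colimit.hom_ext fun i ↦ h i.1 i.2

/-- The transition morphisms between partial colimits. -/
def partialMap {B B' : DirectedSubset kappa mu I} (f : B ⟶ B') :
    partialColimit G B ⟶ partialColimit G B' :=
  partialDesc B (fun i hi ↦ partialι B' i (DirectedSubset.mem_of_hom f hi))
    fun _ _ _ _ _ ↦ map_partialι _ _ _ _ _

@[simp]
theorem partialι_partialMap {B B' : DirectedSubset kappa mu I} (f : B ⟶ B') (i : I)
    (hi : i ∈ B.1) :
    partialι B i hi ≫ partialMap G f = partialι B' i (DirectedSubset.mem_of_hom f hi) :=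
  partialι_partialDesc ..

@[simp]
theorem partialι_partialMap_assoc {B B' : DirectedSubset kappa mu I} (f : B ⟶ B') (i : I)
    (hi : i ∈ B.1) {Y : C} (g : partialColimit G B' ⟶ Y) :
    partialι B i hi ≫ partialMap G f ≫ g = partialι B' i (DirectedSubset.mem_of_hom f hi) ≫ g := by
  rw [← Category.assoc, partialι_partialMap]

variable (kappa mu) in
/-- The colimits of the restrictions of a diagram to the small directed subsets of its index. -/
abbrev partialColimits : DirectedSubset kappa mu I ⥤ C where
  obj B := partialColimit G B
  map f := partialMap G f
  map_id B := partial_hom_ext _ fun _ _ ↦ by simp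
  map_comp f g := partial_hom_ext _ fun _ _ ↦ by simp

variable {G} in
theorem partialι_app {B B' : DirectedSubset kappa mu I} (f : B ⟶ B')
    (s : Cocone (partialColimits kappa mu G)) (i : I) (hi : i ∈ B.1) :
    partialι B i hi ≫ s.ι.app B =
      partialι B' i (DirectedSubset.mem_of_hom f hi) ≫ s.ι.app B' := by
  rw [← s.w f]
  exact partialι_partialMap_assoc G f i hi (s.ι.app B')

variable {G} (c : Cocone G)

/-- The morphism from a partial colimit induced by a cocone. -/
def partialCoconeDesc (B : DirectedSubset kappa mu I) : partialColimit G B ⟶ c.pt :=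
  partialDesc B (fun i _ ↦ c.ι.app i) fun _ _ _ _ h ↦ c.w h

@[simp]
theorem partialι_partialCoconeDesc (B : DirectedSubset kappa mu I) (i : I) (hi : i ∈ B.1) :
    partialι B i hi ≫ partialCoconeDesc c B = c.ι.app i :=
  partialι_partialDesc ..

@[simp]
theorem partialι_partialCoconeDesc_assoc (B : DirectedSubset kappa mu I) (i : I) (hi : i ∈ B.1)
    {Y : C} (g : c.pt ⟶ Y) : partialι B i hi ≫ partialCoconeDesc c B ≫ g = c.ι.app i ≫ g := by
  rw [← Category.assoc, partialι_partialCoconeDesc]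

theorem partialMap_partialCoconeDesc {B B' : DirectedSubset kappa mu I} (f : B ⟶ B') :
    partialMap G f ≫ partialCoconeDesc c B' = partialCoconeDesc c B :=
  partial_hom_ext _ fun _ _ ↦ by simp

variable (kappa mu) in
/-- A cocone over a diagram induces one over its partial colimits. -/
abbrev partialColimitsCocone : Cocone (partialColimits kappa mu G) where
  pt := c.pt
  ι :=
    { app B := partialCoconeDesc c B
      naturality _ _ f := (partialMap_partialCoconeDesc c f).trans (Category.comp_id _).symm }

variable [Fact mu.IsRegular]

/-- A union of fewer than `mu` small subsets is small by regularity, but need not be directed; the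
sharp inequality encloses it in a small directed subset. -/
theorem SharplyLT.isCardinalFiltered_directedSubset (h : SharplyLT kappa mu)
    [IsCardinalFiltered I kappa] : IsCardinalFiltered (DirectedSubset kappa mu I) mu := by
  refine isCardinalFiltered_preorder _ _ fun K s hK ↦ ?_
  obtain ⟨B, hB, h1, h2⟩ := h.exists_directed_set (⋃ k, (s k).1)
    (hasCardinalLT_iUnion _ (by rwa [hasCardinalLT_iff_cardinal_mk_lt]) fun k ↦ (s k).2.2)
  exact ⟨⟨B, h1, h2⟩, fun k ↦ (Set.subset_iUnion (fun k ↦ (s k).1) k).trans hB⟩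

theorem SharplyLT.exists_mem_directedSubset (h : SharplyLT kappa mu)
    [IsCardinalFiltered I kappa] (i : I) : ∃ B : DirectedSubset kappa mu I, i ∈ B.1 := by
  obtain ⟨B, hB, h1, h2⟩ := h.exists_directed_set {i}
    (hasCardinalLT_of_finite _ _ (Fact.out : mu.IsRegular).aleph0_le)
  exact ⟨⟨B, h1, h2⟩, hB rfl⟩

variable {c} in
/-- A colimit is the colimit of its partial colimits. -/
def SharplyLT.isColimitPartialColimitsCocone (h : SharplyLT kappa mu)
    [IsCardinalFiltered I kappa] (hc : IsColimit c) :
    IsColimit (partialColimitsCocone kappa mu c) :=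
  have := h.isCardinalFiltered_directedSubset (I := I)
  have := isFiltered_of_isCardinalFiltered (DirectedSubset kappa mu I) mu
  let B (i : I) : DirectedSubset kappa mu I := (h.exists_mem_directedSubset i).choose
  have hB (i : I) : i ∈ (B i).1 := (h.exists_mem_directedSubset i).choose_spec
  -- The leg at `i` does not depend on the subset containing `i`, because any two such subsets lie
  -- in a third.
  have key (s : Cocone (partialColimits kappa mu G)) (i : I) (B₁ B₂ : DirectedSubset kappa mu I)
      (h₁ : i ∈ B₁.1) (h₂ : i ∈ B₂.1) :
      partialι B₁ i h₁ ≫ s.ι.app B₁ = partialι B₂ i h₂ ≫ s.ι.app B₂ := by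
    rw [partialι_app (IsFiltered.leftToMax B₁ B₂), partialι_app (IsFiltered.rightToMax B₁ B₂)]
  { desc s := hc.desc
      { pt := s.pt
        ι :=
          { app i := partialι (B i) i (hB i) ≫ s.ι.app (B i)
            naturality i j f := by
              let B' := IsFiltered.max (B i) (B j)
              have hi : i ∈ B'.1 := DirectedSubset.mem_of_hom (IsFiltered.leftToMax _ _) (hB i)
              have hj : j ∈ B'.1 := DirectedSubset.mem_of_hom (IsFiltered.rightToMax _ _) (hB j)
              refine (congr(G.map f ≫ $(key s j (B j) B' (hB j) hj))).trans ?_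
              refine Eq.trans ?_ congr($(key s i B' (B i) hi (hB i)) ≫ 𝟙 s.pt)
              exact ((Category.assoc ..).symm.trans congr($(map_partialι G B' hi hj f) ≫ _)).trans
                (Category.comp_id _).symm } }
    fac s B' := partial_hom_ext _ fun i hi ↦
      (partialι_partialCoconeDesc_assoc c B' i hi _).trans
        ((hc.fac _ i).trans (key s i _ _ _ _))
    uniq s m hm := hc.hom_ext fun i ↦ by
      rw [hc.fac]
      exact (partialι_partialCoconeDesc_assoc c (B i) i (hB i) m).symm.trans
        congr(partialι (B i) i (hB i) ≫ $(hm (B i))) }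

end

/-- If `kappa` is sharply smaller than `mu`, every `kappa`-filtered colimit is a `mu`-directed
colimit of colimits of diagrams that are `kappa`-directed and have size less than `mu`. -/
theorem SharplyLT.exists_colimitsOfShape [Fact mu.IsRegular] [HasCardinalFilteredColimits.{w} C kappa]
    (h : SharplyLT kappa mu) {J : Type w} [SmallCategory J] [IsCardinalFiltered J kappa] {X : C}
    (hX : P.colimitsOfShape J X) :
    ∃ (S : Type w) (_ : PartialOrder S), IsCardinalFiltered S mu ∧
      (smallDirectedColimits P kappa mu).colimitsOfShape S X := by
  obtain ⟨I, _, _, F, _⟩ := IsCardinalFiltered.exists_cardinal_directed J kappa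
  obtain ⟨p⟩ := hX
  let q := p.reindex F
  refine ⟨DirectedSubset kappa mu I, inferInstance, h.isCardinalFiltered_directedSubset,
    ⟨⟨⟨_, _, h.isColimitPartialColimitsCocone q.isColimit⟩, fun B ↦ ?_⟩⟩⟩
  exact ⟨B.1, inferInstance, B.2.1, B.2.2,
    ⟨.colimit (restrictDiagram q.diag B.1) fun i ↦ q.prop_diag_obj i.1⟩⟩

/-- A `mu`-presentable object is a retract of a `mu`-small `kappa`-directed colimit of
`kappa`-presentable objects if `kappa` is sharply smaller than or equal to `mu`. -/
theorem SharplyLE.exists_retract [Fact mu.IsRegular] [HasCardinalFilteredColimits.{w} C kappa]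
    (h : SharplyLE kappa mu) {J : Type w}
    [SmallCategory J] [IsCardinalFiltered J kappa] {X : C}
    (hX : P.colimitsOfShape J X) [IsCardinalPresentable X mu] :
    ∃ Y, smallDirectedColimits P kappa mu Y ∧ Nonempty (Retract X Y) := by
  -- In either case the identity of `X` factors through a member of a `mu`-directed diagram. If
  -- `kappa = mu`, that member lies in `P` and is a colimit over a point.
  obtain ⟨_, rfl⟩ | h := h
  · obtain ⟨p⟩ := hX
    obtain ⟨j, f, hf⟩ := IsCardinalPresentable.exists_hom_of_isColimit kappa p.isColimit (𝟙 X)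
    refine ⟨_, ⟨PUnit, inferInstance, isCardinalFiltered_preorder _ _ fun _ _ _ ↦
      ⟨⟨⟩, fun _ ↦ le_rfl⟩, hasCardinalLT_of_finite _ _ (Fact.out : kappa.IsRegular).aleph0_le,
      ⟨⟨.self (p.diag.obj j), fun _ ↦ p.prop_diag_obj j⟩⟩⟩, ⟨⟨f, _, hf⟩⟩⟩
  · obtain ⟨S, _, _, ⟨p⟩⟩ := h.exists_colimitsOfShape hX
    obtain ⟨j, f, hf⟩ := IsCardinalPresentable.exists_hom_of_isColimit mu p.isColimit (𝟙 X)
    exact ⟨_, p.prop_diag_obj j, ⟨⟨f, _, hf⟩⟩⟩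

end Decomposition

/-! ### A size bound on classes of objects that does not mention a least index. -/

section EssentiallyBelow

variable {C : Type u} [Category.{v} C]

/-- The full subcategory on `P` has fewer than `delta` isomorphism classes of objects and its sets
of morphisms have fewer than `delta` elements. -/
def EssentiallyBelow (P : ObjectProperty C) (delta : Cardinal.{w}) : Prop :=
  ∃ (ι : Type w) (x : ι → C), HasCardinalLT ι delta ∧ (∀ X, P X → ∃ i, Nonempty (X ≅ x i)) ∧
    ∀ i j, HasCardinalLT (x i ⟶ x j) delta

variable {P : ObjectProperty C} {delta : Cardinal.{w}}

theorem EssentiallyBelow.hom_lt (h : EssentiallyBelow P delta) {X Y : C} (hX : P X) (hY : P Y) :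
    HasCardinalLT (X ⟶ Y) delta := by
  obtain ⟨ι, x, -, hx, hhom⟩ := h
  obtain ⟨i, ⟨e⟩⟩ := hx X hX
  obtain ⟨j, ⟨e'⟩⟩ := hx Y hY
  exact (hasCardinalLT_iff_of_equiv (e.homCongr e') _).2 (hhom i j)

theorem EssentiallyBelow.essentiallySmall (h : EssentiallyBelow P delta) :
    ObjectProperty.EssentiallySmall.{w} P := by
  obtain ⟨ι, x, -, hx, -⟩ := h
  refine ⟨.ofObj x, inferInstance, fun X hX ↦ ?_⟩
  obtain ⟨i, ⟨e⟩⟩ := hx X hX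
  exact ⟨x i, ⟨i⟩, ⟨e⟩⟩

end EssentiallyBelow

/-! ### Counting presentable objects and their morphisms. -/

section Counting

variable {C : Type u} [Category.{w} C] {kappa : Cardinal.{w}} [Fact kappa.IsRegular]
  [IsCardinalAccessibleCategory C kappa]

/-- In a `kappa`-accessible category, natural families of maps between morphisms out of
representatives of the `kappa`-presentable objects are induced by morphisms. -/
theorem exists_hom_of_naturality {ι : Type w} {x : ι → C}
    (hx : ∀ X : C, isCardinalPresentable C kappa X → ∃ i, Nonempty (X ≅ x i))
    (hx' : ∀ i, isCardinalPresentable C kappa (x i)) {X Y : C}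
    (e : ∀ i, (x i ⟶ X) → (x i ⟶ Y))
    (he : ∀ i j (f : x i ⟶ x j) (a : x j ⟶ X), e i (f ≫ a) = f ≫ e j a) :
    ∃ f : X ⟶ Y, ∀ i a, a ≫ f = e i a := by
  choose r hr using hx
  have φ (Z : (isCardinalPresentable C kappa).FullSubcategory) : Z.obj ≅ x (r Z.obj Z.property) :=
    (hr Z.obj Z.property).some
  -- The family is extended to all `kappa`-presentable objects by conjugation with the chosen
  -- isomorphisms. By density, `X` is the colimit of its canonical diagram, and the extended family
  -- is a cocone on it.
  let leg (Z : (isCardinalPresentable C kappa).FullSubcategory) (g : Z.obj ⟶ X) : Z.obj ⟶ Y :=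
    (φ Z).hom ≫ e _ ((φ Z).inv ≫ g)
  have hleg (Z i) (u : Z.obj ⟶ x i) (g : x i ⟶ X) : leg Z (u ≫ g) = u ≫ e i g := by
    dsimp only [leg]
    rw [← Category.assoc (φ Z).inv, he, Category.assoc, Iso.hom_inv_id_assoc]
  have hleg' (Z Z') (u : Z.obj ⟶ Z'.obj) (g : Z'.obj ⟶ X) : leg Z (u ≫ g) = u ≫ leg Z' g := by
    have := hleg Z _ (u ≫ (φ Z').hom) ((φ Z').inv ≫ g)
    simpa [leg] using this
  let D := (isCardinalPresentable C kappa).ι.denseAt X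
  let c : Cocone (CostructuredArrow.proj (isCardinalPresentable C kappa).ι X ⋙
      (isCardinalPresentable C kappa).ι) :=
    { pt := Y
      ι :=
        { app g := leg g.left g.hom
          naturality g g' u := by
            have h : u.left.hom ≫ g'.hom = g.hom := CostructuredArrow.w u
            exact ((hleg' _ _ u.left.hom g'.hom).symm.trans congr(leg g.left $h)).trans
              (Category.comp_id _).symm } }
  refine ⟨D.desc c, fun i a ↦ ?_⟩
  let Z : (isCardinalPresentable C kappa).FullSubcategory := ⟨x i, hx' i⟩
  have h1 := D.fac c (CostructuredArrow.mk (Y := Z) a)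
  have h2 := hleg Z i (𝟙 _) a
  rw [Category.id_comp, Category.id_comp] at h2
  exact Eq.trans congr($((Category.id_comp a).symm) ≫ D.desc c) (h1.trans h2)

/-- In a `kappa`-accessible category, morphisms are determined by their composites with morphisms
from representatives of the `kappa`-presentable objects. -/
theorem hom_ext_of_representatives {ι : Type w} {x : ι → C}
    (hx : ∀ X : C, isCardinalPresentable C kappa X → ∃ i, Nonempty (X ≅ x i)) {X Y : C}
    {f g : X ⟶ Y} (h : ∀ i (a : x i ⟶ X), a ≫ f = a ≫ g) : f = g := by
  obtain ⟨J, _, _, ⟨p⟩⟩ :=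
    (isCardinalFilteredGenerator_isCardinalPresentable C kappa).exists_colimitsOfShape X
  refine p.isColimit.hom_ext fun j ↦ ?_
  obtain ⟨i, ⟨φ⟩⟩ := hx _ (p.prop_diag_obj j)
  rw [← cancel_epi φ.inv]
  simpa using h i (φ.inv ≫ p.ι.app j)

/-- An object is determined up to isomorphism by its hom-functor on representatives, so counting
objects reduces to counting such functors. -/
theorem nonempty_iso_of_naturality {ι : Type w} {x : ι → C}
    (hx : ∀ X : C, isCardinalPresentable C kappa X → ∃ i, Nonempty (X ≅ x i))
    (hx' : ∀ i, isCardinalPresentable C kappa (x i)) {X Y : C}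
    (e : ∀ i, (x i ⟶ X) ≃ (x i ⟶ Y))
    (he : ∀ i j (f : x i ⟶ x j) (a : x j ⟶ X), e i (f ≫ a) = f ≫ e j a) : Nonempty (X ≅ Y) := by
  obtain ⟨f, hf⟩ := exists_hom_of_naturality hx hx' (fun i ↦ e i) he
  obtain ⟨g, hg⟩ := exists_hom_of_naturality hx hx' (fun i ↦ (e i).symm) fun i j u a ↦ by
    rw [Equiv.symm_apply_eq, he, Equiv.apply_symm_apply]
  exact ⟨⟨f, g, hom_ext_of_representatives hx fun i a ↦ by rw [← Category.assoc, hf, hg]; simp,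
    hom_ext_of_representatives hx fun i a ↦ by rw [← Category.assoc, hg, hf]; simp⟩⟩

variable {delta : Cardinal.{w}}

theorem hasCardinalLT_set (hd : delta.IsInaccessible) {X : Type w} (hX : HasCardinalLT X delta) :
    HasCardinalLT (Set X) delta := by
  rw [hasCardinalLT_iff_cardinal_mk_lt] at hX ⊢
  rw [Cardinal.mk_set]
  exact hd.isStrongPrelimit hX

/-- Objects receiving at most `nu` morphisms from each of the representatives of the
`kappa`-presentable objects form an essentially bounded class. -/
theorem EssentiallyBelow.of_hom_le (hd : delta.IsInaccessible)
    (h : EssentiallyBelow (isCardinalPresentable C kappa) delta) {Q : ObjectProperty C}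
    {nu : Cardinal.{w}} (hnu : nu < delta)
    (hQ : ∀ X Y, isCardinalPresentable C kappa X → Q Y → Cardinal.mk (X ⟶ Y) ≤ nu) :
    EssentiallyBelow Q delta := by
  have : Fact delta.IsRegular := ⟨hd.isRegular⟩
  have h0 := hd.aleph0_lt.le
  obtain ⟨ι, x, hι, hx, hx', hhom⟩ : ∃ (ι : Type w) (x : ι → C), HasCardinalLT ι delta ∧
      (∀ X, isCardinalPresentable C kappa X → ∃ i, Nonempty (X ≅ x i)) ∧
      (∀ i, isCardinalPresentable C kappa (x i)) ∧
      ∀ i j, HasCardinalLT (x i ⟶ x j) delta := by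
    obtain ⟨ι, x, hι, hx, hhom⟩ := h
    refine ⟨{i // isCardinalPresentable C kappa (x i)}, fun i ↦ x i.1,
      hι.of_injective _ Subtype.val_injective, fun X hX ↦ ?_, fun i ↦ i.2, fun i j ↦ hhom _ _⟩
    obtain ⟨i, ⟨e⟩⟩ := hx X hX
    exact ⟨⟨i, (isCardinalPresentable C kappa).prop_of_iso e hX⟩, ⟨e⟩⟩
  let Z := nu.out
  have hZ : HasCardinalLT Z delta := by
    rw [hasCardinalLT_iff_cardinal_mk_lt, Cardinal.mk_out]; exact hnu
  have emb (Y : Subtype Q) (i : ι) : Nonempty ((x i ⟶ Y.1) ↪ Z) := by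
    rw [← Cardinal.le_def, Cardinal.mk_out]
    exact hQ _ _ (hx' i) Y.2
  replace emb (Y : Subtype Q) (i : ι) : (x i ⟶ Y.1) ↪ Z := (emb Y i).some
  -- The hom-functor of an object is transported into `Z`: the first set records the images of its
  -- values, the second the graph of precomposition. Equal codes give a natural bijection, and there
  -- are fewer than `delta` codes because `delta` is a strong limit.
  let Code : Type w := Set (ι × Z) × Set ((Σ p : ι × ι, (x p.1 ⟶ x p.2)) × Z × Z)
  let code (Y : Subtype Q) : Code :=
    ({p | p.2 ∈ Set.range (emb Y p.1)},
      {p | ∃ a, p.2.1 = emb Y p.1.1.2 a ∧ p.2.2 = emb Y p.1.1.1 (p.1.2 ≫ a)})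
  have hcode : HasCardinalLT Code delta := by
    refine hasCardinalLT_prod h0 (hasCardinalLT_set hd (hasCardinalLT_prod h0 hι hZ))
      (hasCardinalLT_set hd (hasCardinalLT_prod h0 (hasCardinalLT_sigma _ _
        (hasCardinalLT_prod h0 hι hι) fun p ↦ hhom _ _) (hasCardinalLT_prod h0 hZ hZ)))
  have hiso (Y Y' : Subtype Q) (hY : code Y = code Y') : Nonempty (Y.1 ≅ Y'.1) := by
    have h1 (i) : Set.range (emb Y i) = Set.range (emb Y' i) := by
      ext z
      exact Set.ext_iff.1 congr(($hY).1) (i, z)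
    let e (i) : (x i ⟶ Y.1) ≃ (x i ⟶ Y'.1) :=
      (Equiv.ofInjective _ (emb Y i).injective).trans ((Equiv.setCongr (h1 i)).trans
        (Equiv.ofInjective _ (emb Y' i).injective).symm)
    have he (i a) : emb Y' i (e i a) = emb Y i a :=
      Equiv.apply_ofInjective_symm (emb Y' i).injective _
    refine nonempty_iso_of_naturality hx hx' e fun i j f a ↦ ?_
    obtain ⟨b, hb, hb'⟩ : (⟨⟨(i, j), f⟩, emb Y j a, emb Y i (f ≫ a)⟩ :
        (Σ p : ι × ι, (x p.1 ⟶ x p.2)) × Z × Z) ∈ (code Y').2 := by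
      rw [← hY]
      exact ⟨a, rfl, rfl⟩
    dsimp only at b hb hb'
    rw [← he] at hb hb'
    rw [(emb Y' j).injective hb, (emb Y' i).injective hb']
  refine ⟨Set.range code, fun c ↦ c.2.choose.1, hcode.of_injective _ Subtype.val_injective,
    fun Y hY ↦ ⟨⟨code ⟨Y, hY⟩, ⟨_, rfl⟩⟩, hiso ⟨Y, hY⟩ _ ?_⟩, fun c c' ↦ ?_⟩
  · exact (Set.mem_range_self (f := code) ⟨Y, hY⟩).choose_spec.symm
  · set Y := c.2.choose
    set Y' := c'.2.choose
    have hhomlt (Y : Subtype Q) (i) : HasCardinalLT (x i ⟶ Y.1) delta :=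
      hZ.of_injective _ (emb Y i).injective
    have := hasCardinalLT_set hd (hasCardinalLT_sigma (fun i ↦ (x i ⟶ Y.1) × (x i ⟶ Y'.1)) delta hι
      fun i ↦ hasCardinalLT_prod h0 (hhomlt Y i) (hhomlt Y' i))
    -- A morphism is coded by the graph of its action on morphisms from representatives.
    refine this.of_injective (fun f ↦ {p | p.2.1 ≫ f = p.2.2}) fun f g hfg ↦ ?_
    refine hom_ext_of_representatives hx fun i a ↦ ?_
    exact ((Set.ext_iff.1 hfg ⟨i, a, a ≫ f⟩).1 rfl).symm

/-- If the `kappa`-presentable objects form an essentially bounded class, then so do the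
`mu`-presentable objects. -/
theorem EssentiallyBelow.of_sharplyLE (hd : delta.IsInaccessible)
    (h : EssentiallyBelow (isCardinalPresentable C kappa) delta) {mu : Cardinal.{w}}
    [Fact mu.IsRegular] (hmu : mu < delta) (hs : SharplyLE kappa mu) :
    EssentiallyBelow (isCardinalPresentable C mu) delta := by
  have : Fact delta.IsRegular := ⟨hd.isRegular⟩
  obtain ⟨ι, x, hι, hx, hhom⟩ := id h
  -- This product bounds the morphisms from a `kappa`-presentable `X` to `Y`: with `Y` a retract of
  -- a colimit over `I`, such a morphism is recovered from an index in `I`, which embeds in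
  -- `mu.out`, and a morphism between representatives.
  have hS := hasCardinalLT_prod hd.aleph0_lt.le
    (show HasCardinalLT mu.out delta by rwa [hasCardinalLT_iff_cardinal_mk_lt, Cardinal.mk_out])
    (hasCardinalLT_sigma (fun p : ι × ι ↦ (x p.1 ⟶ x p.2)) delta
      (hasCardinalLT_prod hd.aleph0_lt.le hι hι) fun p ↦ hhom _ _)
  rw [hasCardinalLT_iff_cardinal_mk_lt] at hS
  refine h.of_hom_le hd hS fun X Y hX hY ↦ ?_
  have : IsCardinalPresentable X kappa := hX
  have : IsCardinalPresentable Y mu := hY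
  obtain ⟨J, _, _, hJ⟩ :=
    (isCardinalFilteredGenerator_isCardinalPresentable C kappa).exists_colimitsOfShape Y
  obtain ⟨Y', ⟨I, _, _, hI, ⟨p⟩⟩, ⟨r⟩⟩ := hs.exists_retract hJ
  have hI' : Nonempty (I ↪ mu.out) := by
    rw [← Cardinal.le_def, Cardinal.mk_out]
    exact ((hasCardinalLT_iff_cardinal_mk_lt _ _).1 hI).le
  have hX' (f : X ⟶ Y) : ∃ (i : I) (g : X ⟶ p.diag.obj i), g ≫ p.ι.app i = f ≫ r.i :=
    IsCardinalPresentable.exists_hom_of_isColimit kappa p.isColimit (f ≫ r.i)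
  choose i g hg using hX'
  obtain ⟨k, ⟨φ⟩⟩ := hx X hX
  choose l hl using fun i ↦ hx _ (p.prop_diag_obj i)
  have ψ (i) := (hl i).some
  refine Cardinal.mk_le_of_injective (f := fun f ↦
    (hI'.some (i f), ⟨(k, l (i f)), φ.inv ≫ g f ≫ (ψ (i f)).hom⟩)) fun f f' hff' ↦ ?_
  -- Variable indices allow the equality of dependent pairs to be eliminated.
  have hgen : ∀ a a' (b : X ⟶ p.diag.obj a) (b' : X ⟶ p.diag.obj a'), a = a' →
      (⟨(k, l a), φ.inv ≫ b ≫ (ψ a).hom⟩ : Σ p : ι × ι, (x p.1 ⟶ x p.2)) =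
        ⟨(k, l a'), φ.inv ≫ b' ≫ (ψ a').hom⟩ → b ≫ p.ι.app a = b' ≫ p.ι.app a' := by
    rintro a _ b b' rfl hb
    obtain rfl : b = b' := by simpa using hb
    rfl
  simp only [Prod.mk.injEq] at hff'
  have := hgen _ _ (g f) (g f') (hI'.some.injective hff'.1) hff'.2
  rw [hg, hg] at this
  simpa using congr($this ≫ r.r)

/-- A functor which preserves `kappa`-filtered colimits and `kappa`-presentable objects also
preserves `mu`-presentable objects if `kappa` is sharply smaller than or equal to `mu`. -/
theorem isCardinalPresentable_obj_of_sharplyLE {D : Type u'} [Category.{w} D] (F : C ⥤ D)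
    [F.IsCardinalAccessible kappa]
    (hF : ∀ X, isCardinalPresentable C kappa X → isCardinalPresentable D kappa (F.obj X))
    {mu : Cardinal.{w}} [Fact mu.IsRegular] (hs : SharplyLE kappa mu) (X : C)
    (hX : isCardinalPresentable C mu X) : isCardinalPresentable D mu (F.obj X) := by
  have : IsCardinalPresentable X mu := hX
  obtain ⟨J, _, _, hJ⟩ :=
    (isCardinalFilteredGenerator_isCardinalPresentable C kappa).exists_colimitsOfShape X
  obtain ⟨Y, ⟨I, _, _, hI, ⟨p⟩⟩, ⟨r⟩⟩ := hs.exists_retract hJ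
  have := F.preservesColimitsOfShape_of_isCardinalAccessible kappa I
  have hY : isCardinalPresentable D mu (F.obj Y) :=
    smallDirectedColimits_le_isCardinalPresentable le_rfl hs.le _
      ⟨I, inferInstance, inferInstance, hI, ⟨p.toColimitPresentation.map F,
        fun i ↦ hF _ (p.prop_diag_obj i)⟩⟩
  exact (isCardinalPresentable D mu).prop_of_retract (r.map F) hY

end Counting

/-! ### Comparison of the size bound with the parameters `μ`. -/

section Below

variable {C : Type (w + 1)} [Category.{w} C] {delta : Cardinal.{w}}

theorem presentable_eq (kappa : Cardinal.{w}) [h : Fact kappa.IsRegular] :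
    (fun X : C ↦ Presentable kappa X) = isCardinalPresentable C kappa := by
  funext X
  exact propext ⟨fun h ↦ h.2, fun h' ↦ ⟨h, h'⟩⟩

theorem hasCardinalLT_arrow_pres_iff {lam : Cardinal.{w}} (h : AccessibleCat C lam) :
    HasCardinalLT (Arrow (Pres C lam)) delta ↔ presCard C lam < delta := by
  rw [HasCardinalLT, ← lift_presCard h]
  simp

theorem EssentiallyBelow.of_presCard_lt {lam : Cardinal.{w}} [Fact lam.IsRegular]
    (h : AccessibleCat C lam) (hlt : presCard C lam < delta) :
    EssentiallyBelow (isCardinalPresentable C lam) delta := by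
  rw [← hasCardinalLT_arrow_pres_iff h] at hlt
  rw [← presentable_eq]
  have hobj : HasCardinalLT (Pres C lam) delta :=
    hlt.of_injective (fun X ↦ Arrow.mk (𝟙 X)) fun X Y hXY ↦ congr(($hXY).left)
  have : Small.{w} (Pres C lam) := hobj.small
  refine ⟨Shrink.{w} (Pres C lam),
    fun i ↦ ((fromSkeleton _).obj ((equivShrink _).symm i)).obj,
    (hasCardinalLT_iff_of_equiv (equivShrink _) _).1 hobj, fun X hX ↦ ?_, fun i j ↦ ?_⟩
  · let X' : ObjectProperty.FullSubcategory (fun X : C ↦ Presentable lam X) := ⟨X, hX⟩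
    refine ⟨equivShrink _ ((fromSkeleton _).objPreimage X'), ⟨?_⟩⟩
    dsimp only
    rw [Equiv.symm_apply_apply]
    exact (ObjectProperty.ι _).mapIso ((fromSkeleton _).objObjPreimageIso X').symm
  · set X := (equivShrink (Pres C lam)).symm i
    set Y := (equivShrink (Pres C lam)).symm j
    have h1 : HasCardinalLT (X ⟶ Y) delta :=
      hlt.of_injective (fun f ↦ Arrow.mk f) fun f g hfg ↦ Arrow.mk_injective _ _ hfg
    exact h1.of_surjective (fun f ↦ (fromSkeleton _ ⋙ ObjectProperty.ι _).map f)
      ((fromSkeleton _ ⋙ ObjectProperty.ι _).map_surjective)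

theorem EssentiallyBelow.presCard_lt [Fact delta.IsRegular] {lam kappa : Cardinal.{w}}
    [Fact kappa.IsRegular] (h : EssentiallyBelow (isCardinalPresentable C kappa) delta)
    (hl : AccessibleCat C lam) (hle : lam ≤ kappa) : presCard C lam < delta := by
  rw [← hasCardinalLT_arrow_pres_iff hl]
  have : Fact lam.IsRegular := hl.1
  let F : Pres C lam ⥤ C := fromSkeleton _ ⋙ ObjectProperty.ι _
  have hF (X : Pres C lam) : isCardinalPresentable C kappa (F.obj X) :=
    isCardinalPresentable_monotone C hle _
      (by rw [← presentable_eq]; exact ((fromSkeleton _).obj X).property)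
  have hobj : HasCardinalLT (Pres C lam) delta := by
    obtain ⟨ι, x, hι, hx, -⟩ := h
    choose i hi using fun X ↦ hx _ (hF X)
    refine hι.of_injective i fun X Y hXY ↦ ?_
    have e : F.obj X ≅ F.obj Y := (hi X).some ≪≫ eqToIso (by rw [hXY]) ≪≫ (hi Y).some.symm
    exact skeleton_skeletal _ ⟨F.preimageIso e⟩
  refine (hasCardinalLT_sigma (fun p : Pres C lam × Pres C lam ↦ (p.1 ⟶ p.2)) delta
    (hasCardinalLT_prod (Fact.out : delta.IsRegular).aleph0_le hobj hobj) fun p ↦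
      (h.hom_lt (hF p.1) (hF p.2)).of_injective _ F.map_injective).of_injective
    (fun a ↦ ⟨(a.left, a.right), a.hom⟩) ?_
  rintro ⟨a, b, g⟩ ⟨a', b', g'⟩ h
  simp only [Sigma.mk.injEq, Prod.mk.injEq] at h
  obtain ⟨⟨rfl, rfl⟩, h⟩ := h
  obtain rfl := eq_of_heq h
  rfl

theorem EssentiallyBelow.muCat_lt (hd : delta.IsInaccessible) {lam kappa : Cardinal.{w}}
    [Fact kappa.IsRegular] (h : EssentiallyBelow (isCardinalPresentable C kappa) delta)
    (hk : kappa < delta) (hl : AccessibleCat C lam) (hle : lam ≤ kappa) : muCat C lam < delta :=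
  have : Fact delta.IsRegular := ⟨hd.isRegular⟩
  muCard_lt hd (h.presCard_lt hl hle) (hle.trans_lt hk) hl.1.out

/-- The least index of accessibility is at most `kappa`, and its presentable objects are
`kappa`-presentable, so the bound passes down to it. -/
theorem EssentiallyBelow.categoryBelow (hd : delta.IsInaccessible) {kappa : Cardinal.{w}}
    [hreg : Fact kappa.IsRegular] [hacc : IsCardinalAccessibleCategory C kappa]
    (h : EssentiallyBelow (isCardinalPresentable C kappa) delta) (hk : kappa < delta) :
    CategoryBelow C delta := by
  have hmem : kappa ∈ {l : Cardinal.{w} | AccessibleCat C l} := ⟨hreg, hacc⟩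
  have hmin := csInf_mem (Set.nonempty_of_mem hmem)
  exact ⟨_, ⟨hmin, fun l hl ↦ csInf_le' hl⟩, h.muCat_lt hd hk hmin (csInf_le' hmem)⟩

/-- If `C` is below `delta` then the class of its `kappa`-presentable objects is essentially bounded
whenever `C` is `kappa`-accessible and `kappa < delta`. -/
theorem CategoryBelow.essentiallyBelow (hd : delta.IsInaccessible) (h : CategoryBelow C delta)
    {kappa : Cardinal.{w}} [hreg : Fact kappa.IsRegular]
    [hacc : IsCardinalAccessibleCategory C kappa] (hk : kappa < delta) :
    EssentiallyBelow (isCardinalPresentable C kappa) delta := by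
  obtain ⟨lam, ⟨hlam, hmin⟩, hlt⟩ := h
  have hle : lam ≤ kappa := hmin ⟨hreg, hacc⟩
  have := hlam.1
  have := hlam.2
  have h1 := EssentiallyBelow.of_presCard_lt hlam
    ((lt_muCard (presCard C lam) hlam.1.out).trans hlt)
  -- The least index `lam` need not be sharply below `kappa`. The bound is raised to some `γ ≥
  -- kappa` with `lam` sharply below or equal to `γ`, and then restricted to `kappa`.
  have hg := gammaCard_mem kappa hlam.1.out
  have : Fact (gammaCard kappa lam).IsRegular := ⟨hg.2.regular_right⟩
  have h2 := h1.of_sharplyLE hd (gammaCard_lt hd hk (hle.trans_lt hk) hlam.1.out) hg.2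
  obtain ⟨ι, x, hι, hx, hhom⟩ := h2
  exact ⟨ι, x, hι, fun X hX ↦ hx X (isCardinalPresentable_monotone C hg.1 _ hX), hhom⟩

/-- Preservation of presentable objects passes from `kappa` to every cardinal sharply above it. Some
such cardinal below `delta` also exceeds `muCat D lam`, which bounds the least candidate for `μ_F`.
-/
theorem functorBelow_of_preserves {D : Type (w + 1)} [Category.{w} D] (hd : delta.IsInaccessible)
    {kappa : Cardinal.{w}} [hreg : Fact kappa.IsRegular] [hC : IsCardinalAccessibleCategory C kappa]
    [hD : IsCardinalAccessibleCategory D kappa]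
    (h : EssentiallyBelow (isCardinalPresentable D kappa) delta) (hk : kappa < delta)
    (F : C ⥤ D) [hF : F.IsCardinalAccessible kappa]
    (hF' : ∀ X, isCardinalPresentable C kappa X → isCardinalPresentable D kappa (F.obj X)) :
    FunctorBelow F delta := by
  have hmem : kappa ∈ {l : Cardinal.{w} | AccessibleFunctor F l} := ⟨hreg, hC, hD, hF⟩
  have hmin := csInf_mem (Set.nonempty_of_mem hmem)
  set lam := sInf {l : Cardinal.{w} | AccessibleFunctor F l}
  have hmu := h.muCat_lt hd hk (lam := lam) ⟨hmin.1, hmin.2.2.1⟩ (csInf_le' hmem)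
  have hg := gammaCard_mem (muCat D lam) hreg.out
  have hgl := gammaCard_lt hd hmu hk hreg.out
  have : Fact (gammaCard (muCat D lam) kappa).IsRegular := ⟨hg.2.regular_right⟩
  have hmem' : gammaCard (muCat D lam) kappa ∈
      {m : Cardinal.{w} | m.IsRegular ∧ muCat D lam ≤ m ∧ PreservesPresentable F m} :=
    ⟨this.out, hg.1, fun X hX ↦
      ⟨this, isCardinalPresentable_obj_of_sharplyLE F hF' hg.2 X hX.2⟩⟩
  exact ⟨_, ⟨lam, ⟨hmin, fun l hl ↦ csInf_le' hl⟩, csInf_mem (Set.nonempty_of_mem hmem'),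
    fun l hl ↦ csInf_le' hl⟩, (csInf_le' hmem').trans_lt hgl⟩

end Below

/-! ### Accessibility and presentable objects of comma categories. -/

section Comma

variable {A : Type u₁} [Category.{v₁} A] {B : Type u₂} [Category.{v₂} B]
  {T : Type u₃} [Category.{w} T] (L : A ⥤ T) (R : B ⥤ T)
  (kappa : Cardinal.{w}) [Fact kappa.IsRegular]

variable {kappa} in
/-- A criterion for presentability in terms of factorizations of morphisms to colimits. -/
theorem isCardinalPresentable_of_exists {X : A}
    (h₁ : ∀ (J : Type w) [SmallCategory J] [IsCardinalFiltered J kappa] (D : J ⥤ A) (c : Cocone D)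
      (_ : IsColimit c) (f : X ⟶ c.pt), ∃ (j : J) (g : X ⟶ D.obj j), g ≫ c.ι.app j = f)
    (h₂ : ∀ (J : Type w) [SmallCategory J] [IsCardinalFiltered J kappa] (D : J ⥤ A) (c : Cocone D)
      (_ : IsColimit c) (j : J) (f g : X ⟶ D.obj j), f ≫ c.ι.app j = g ≫ c.ι.app j →
        ∃ (k : J) (s : j ⟶ k), f ≫ D.map s = g ≫ D.map s) : IsCardinalPresentable X kappa where
  preservesColimitOfShape J _ _ := ⟨fun {D} ↦ ⟨fun {c} hc ↦ ⟨by
    have := isFiltered_of_isCardinalFiltered J kappa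
    refine Types.FilteredColimit.isColimitOf' _ _ (fun f ↦ ?_) (fun j f g h ↦ h₂ J D c hc j f g h)
    obtain ⟨j, g, hg⟩ := h₁ J D c hc f
    exact ⟨j, g, hg.symm⟩⟩⟩⟩

/-- The objects of a comma category with `kappa`-presentable source and target. -/
def presentableComma : ObjectProperty (Comma L R) :=
  fun x ↦ isCardinalPresentable A kappa x.left ∧ isCardinalPresentable B kappa x.right

section

variable {L R kappa} {I J : Type w} [PartialOrder I] [PartialOrder J] {a : A} {b : B}
  (p : (isCardinalPresentable A kappa).ColimitOfShape I a)
  (q : (isCardinalPresentable B kappa).ColimitOfShape J b) (h : L.obj a ⟶ R.obj b)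

/-- The factorizations of a morphism `L.obj a ⟶ R.obj b` through members of diagrams with
colimits `a` and `b`. -/
structure CommaIndex where
  /-- the index of the source -/
  i : I
  /-- the index of the target -/
  j : J
  /-- the factorization -/
  hom : L.obj (p.diag.obj i) ⟶ R.obj (q.diag.obj j)
  w : hom ≫ R.map (q.ι.app j) = L.map (p.ι.app i) ≫ h

instance : Preorder (CommaIndex p q h) where
  le x y := ∃ (hi : x.i ≤ y.i) (hj : x.j ≤ y.j),
    L.map (p.diag.map (homOfLE hi)) ≫ y.hom = x.hom ≫ R.map (q.diag.map (homOfLE hj))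
  le_refl x := ⟨le_rfl, le_rfl, by simp⟩
  le_trans x y z := by
    rintro ⟨hi, hj, hxy⟩ ⟨hi', hj', hyz⟩
    refine ⟨hi.trans hi', hj.trans hj', ?_⟩
    change L.map (p.diag.map (homOfLE hi ≫ homOfLE hi')) ≫ z.hom =
      x.hom ≫ R.map (q.diag.map (homOfLE hj ≫ homOfLE hj'))
    rw [p.diag.map_comp, L.map_comp, Category.assoc, hyz, ← Category.assoc, hxy, Category.assoc,
      q.diag.map_comp, R.map_comp]

/-- The index of the source, as a functor. -/
def commaIndexLeft : CommaIndex p q h ⥤ I :=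
  Monotone.functor (f := CommaIndex.i) fun _ _ h ↦ h.1

/-- The index of the target, as a functor. -/
def commaIndexRight : CommaIndex p q h ⥤ J :=
  Monotone.functor (f := CommaIndex.j) fun _ _ h ↦ h.2.1

/-- The diagram of the factorizations of a morphism. -/
abbrev commaDiagram : CommaIndex p q h ⥤ Comma L R where
  obj x := { left := p.diag.obj x.i, right := q.diag.obj x.j, hom := x.hom }
  map f :=
    { left := p.diag.map (homOfLE (leOfHom f).1)
      right := q.diag.map (homOfLE (leOfHom f).2.1)
      w := (leOfHom f).2.2 }
  map_id x := by
    ext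
    · exact p.diag.map_id _
    · exact q.diag.map_id _
  map_comp f g := by
    ext
    · exact p.diag.map_comp _ _
    · exact q.diag.map_comp _ _

/-- The cocone on the diagram of the factorizations of a morphism. -/
abbrev commaCocone : Cocone (commaDiagram p q h) where
  pt := { left := a, right := b, hom := h }
  ι :=
    { app x :=
        { left := p.ι.app x.i
          right := q.ι.app x.j
          w := x.w.symm }
      naturality x y f := by
        ext
        · exact p.ι.naturality (homOfLE (leOfHom f).1)
        · exact q.ι.naturality (homOfLE (leOfHom f).2.1) }

variable [R.IsCardinalAccessible kappa] [IsCardinalFiltered J kappa]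
  (hL : ∀ a, isCardinalPresentable A kappa a → isCardinalPresentable T kappa (L.obj a))

include hL

/-- As `L.obj (p.diag.obj i)` is presentable and `R` preserves the colimit `b`, a factorization
exists, and its target index can be increased at will. -/
theorem exists_commaIndex (i : I) (j : J) : ∃ x : CommaIndex p q h, x.i = i ∧ j ≤ x.j := by
  have := isFiltered_of_isCardinalFiltered J kappa
  have : IsCardinalPresentable (L.obj (p.diag.obj i)) kappa := hL _ (p.prop_diag_obj i)
  have := R.preservesColimitsOfShape_of_isCardinalAccessible kappa J
  obtain ⟨k, f, hf⟩ : ∃ (k : J) (f : L.obj (p.diag.obj i) ⟶ R.obj (q.diag.obj k)),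
      f ≫ R.map (q.ι.app k) = L.map (p.ι.app i) ≫ h :=
    IsCardinalPresentable.exists_hom_of_isColimit kappa (isColimitOfPreserves R q.isColimit) _
  refine ⟨⟨i, IsFiltered.max j k, f ≫ R.map (q.diag.map (IsFiltered.rightToMax _ _)), ?_⟩, rfl,
    leOfHom (IsFiltered.leftToMax _ _)⟩
  rw [Category.assoc, ← R.map_comp, q.w, hf]

variable [IsCardinalFiltered I kappa]

theorem isCardinalFiltered_commaIndex : IsCardinalFiltered (CommaIndex p q h) kappa := by
  have := isFiltered_of_isCardinalFiltered J kappa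
  refine isCardinalFiltered_preorder _ _ fun K s hK ↦ ?_
  rw [← hasCardinalLT_iff_cardinal_mk_lt] at hK
  obtain ⟨x, hxi, hxj⟩ := exists_commaIndex p q h hL
    (IsCardinalFiltered.max (fun k ↦ (s k).i) hK) (IsCardinalFiltered.max (fun k ↦ (s k).j) hK)
  have hi (k) : (s k).i ≤ x.i :=
    (leOfHom (IsCardinalFiltered.toMax (fun k ↦ (s k).i) hK k)).trans hxi.ge
  have hj (k) : (s k).j ≤ x.j :=
    (leOfHom (IsCardinalFiltered.toMax (fun k ↦ (s k).j) hK k)).trans hxj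
  have := R.preservesColimitsOfShape_of_isCardinalAccessible kappa J
  -- The square comparing `s k` with `x` commutes only in `R.obj b`. By presentability it already
  -- commutes at a stage `l k`, and fewer than `kappa` stages have a common bound.
  have key (k) : ∃ (l : J) (hl : x.j ≤ l),
      (L.map (p.diag.map (homOfLE (hi k))) ≫ x.hom) ≫ R.map (q.diag.map (homOfLE hl)) =
        ((s k).hom ≫ R.map (q.diag.map (homOfLE (hj k)))) ≫ R.map (q.diag.map (homOfLE hl)) := by
    have : IsCardinalPresentable (L.obj (p.diag.obj (s k).i)) kappa := hL _ (p.prop_diag_obj _)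
    obtain ⟨l, u, hu⟩ := IsCardinalPresentable.exists_eq_of_isColimit' kappa
      (isColimitOfPreserves R q.isColimit) (i := x.j)
      (L.map (p.diag.map (homOfLE (hi k))) ≫ x.hom)
      ((s k).hom ≫ R.map (q.diag.map (homOfLE (hj k)))) (by
        change _ ≫ R.map (q.ι.app x.j) = _ ≫ R.map (q.ι.app x.j)
        rw [Category.assoc, Category.assoc, x.w, ← R.map_comp, q.w, (s k).w, ← Category.assoc,
          ← L.map_comp, p.w])
    exact ⟨l, leOfHom u, hu⟩
  choose l hl hl' using key
  let m := IsFiltered.max x.j (IsCardinalFiltered.max l hK)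
  have hm : x.j ≤ m := leOfHom (IsFiltered.leftToMax _ _)
  have hlm (k) : l k ≤ m := (leOfHom (IsCardinalFiltered.toMax l hK k)).trans
    (leOfHom (IsFiltered.rightToMax _ _))
  refine ⟨⟨x.i, m, x.hom ≫ R.map (q.diag.map (homOfLE hm)), ?_⟩, fun k ↦
    ⟨hi k, (hj k).trans hm, ?_⟩⟩
  · rw [Category.assoc, ← R.map_comp, q.w, x.w]
  · have := congr($(hl' k) ≫ R.map (q.diag.map (homOfLE (hlm k))))
    simpa only [Category.assoc, ← R.map_comp, ← q.diag.map_comp, homOfLE_comp] using this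

theorem final_commaIndexLeft : (commaIndexLeft p q h).Final := by
  have := isCardinalFiltered_commaIndex p q h hL
  have := isFiltered_of_isCardinalFiltered (CommaIndex p q h) kappa
  have : Nonempty J := IsCardinalFiltered.nonempty J kappa
  rw [Functor.final_iff_of_isFiltered]
  refine ⟨fun i ↦ ?_, fun {_ c} _ _ ↦ ⟨c, 𝟙 _, Subsingleton.elim _ _⟩⟩
  obtain ⟨x, hx, -⟩ := exists_commaIndex p q h hL i (Classical.arbitrary J)
  exact ⟨x, ⟨homOfLE hx.ge⟩⟩

theorem final_commaIndexRight : (commaIndexRight p q h).Final := by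
  have := isCardinalFiltered_commaIndex p q h hL
  have := isFiltered_of_isCardinalFiltered (CommaIndex p q h) kappa
  have : Nonempty I := IsCardinalFiltered.nonempty I kappa
  rw [Functor.final_iff_of_isFiltered]
  refine ⟨fun j ↦ ?_, fun {_ c} _ _ ↦ ⟨c, 𝟙 _, Subsingleton.elim _ _⟩⟩
  obtain ⟨x, -, hx⟩ := exists_commaIndex p q h hL (Classical.arbitrary I) j
  exact ⟨x, ⟨homOfLE hx⟩⟩

/-- Both projections of the index are final, so the components of the cocone are colimits; as `L`
preserves the first, they jointly give a colimit in the comma category. -/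
theorem colimitsOfShape_commaIndex [L.IsCardinalAccessible kappa] :
    (presentableComma L R kappa).colimitsOfShape (CommaIndex p q h)
      { left := a, right := b, hom := h } := by
  have := isCardinalFiltered_commaIndex p q h hL
  have := L.preservesColimitsOfShape_of_isCardinalAccessible kappa (CommaIndex p q h)
  have := final_commaIndexLeft p q h hL
  have := final_commaIndexRight p q h hL
  have h₁ := (Functor.Final.isColimitWhiskerEquiv (commaIndexLeft p q h) _).symm p.isColimit
  have h₂ := (Functor.Final.isColimitWhiskerEquiv (commaIndexRight p q h) _).symm q.isColimit
  have hc : IsColimit (commaCocone p q h) := Comma.fstSndJointlyReflectColimit h₁ h₂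
  exact ⟨⟨⟨_, _, hc⟩, fun x ↦ ⟨p.prop_diag_obj _, q.prop_diag_obj _⟩⟩⟩

end

variable {L R kappa} in

theorem essentiallyBelow_presentableComma {delta : Cardinal.{w}} (hd : delta.IsRegular)
    (hA : EssentiallyBelow (isCardinalPresentable A kappa) delta)
    (hB : EssentiallyBelow (isCardinalPresentable B kappa) delta)
    (hT : ∀ a b, isCardinalPresentable A kappa a → isCardinalPresentable B kappa b →
      HasCardinalLT (L.obj a ⟶ R.obj b) delta) :
    EssentiallyBelow (presentableComma L R kappa) delta := by
  have : Fact delta.IsRegular := ⟨hd⟩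
  obtain ⟨ι, x, hι, hx, hhom⟩ := hA
  obtain ⟨ι', x', hι', hx', hhom'⟩ := hB
  -- The representatives need not be presentable, but `hT` bounds morphisms only between presentable
  -- ones.
  let ok := {p : ι × ι' // isCardinalPresentable A kappa (x p.1) ∧
    isCardinalPresentable B kappa (x' p.2)}
  refine ⟨Σ p : ok, (L.obj (x p.1.1) ⟶ R.obj (x' p.1.2)), fun t ↦
    { left := x t.1.1.1, right := x' t.1.1.2, hom := t.2 }, ?_, ?_, ?_⟩
  · exact hasCardinalLT_sigma _ _
      ((hasCardinalLT_prod hd.aleph0_le hι hι').of_injective _ Subtype.val_injective) fun p ↦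
        hT _ _ p.2.1 p.2.2
  · rintro y ⟨hl, hr⟩
    obtain ⟨i, ⟨e⟩⟩ := hx _ hl
    obtain ⟨i', ⟨e'⟩⟩ := hx' _ hr
    let p : ok := ⟨(i, i'), (isCardinalPresentable A kappa).prop_of_iso e hl,
      (isCardinalPresentable B kappa).prop_of_iso e' hr⟩
    exact ⟨⟨p, L.map e.inv ≫ y.hom ≫ R.map e'.hom⟩,
      ⟨Comma.isoMk e e' (by simp [p, ← Functor.map_comp_assoc])⟩⟩
  · intro s t
    refine (hasCardinalLT_prod hd.aleph0_le (hhom s.1.1.1 t.1.1.1)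
      (hhom' s.1.1.2 t.1.1.2)).of_injective (fun f ↦ (f.left, f.right)) fun f g hfg ↦ ?_
    ext
    exacts [congr(($hfg).1), congr(($hfg).2)]

section

variable [L.IsCardinalAccessible kappa] [HasCardinalFilteredColimits.{w} A kappa]
  [HasCardinalFilteredColimits.{w} B kappa]

instance hasCardinalFilteredColimits_comma : HasCardinalFilteredColimits.{w} (Comma L R) kappa where
  hasColimitsOfShape J _ _ := by
    have := L.preservesColimitsOfShape_of_isCardinalAccessible kappa J
    have := HasCardinalFilteredColimits.hasColimitsOfShape (κ := kappa) A J
    have := HasCardinalFilteredColimits.hasColimitsOfShape (κ := kappa) B J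
    infer_instance

instance isCardinalAccessible_comma_fst : (Comma.fst L R).IsCardinalAccessible kappa where
  preservesColimitOfShape J _ _ := by
    have := L.preservesColimitsOfShape_of_isCardinalAccessible kappa J
    have := HasCardinalFilteredColimits.hasColimitsOfShape (κ := kappa) A J
    have := HasCardinalFilteredColimits.hasColimitsOfShape (κ := kappa) B J
    infer_instance

instance isCardinalAccessible_comma_snd : (Comma.snd L R).IsCardinalAccessible kappa where
  preservesColimitOfShape J _ _ := by
    have := L.preservesColimitsOfShape_of_isCardinalAccessible kappa J
    have := HasCardinalFilteredColimits.hasColimitsOfShape (κ := kappa) A J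
    have := HasCardinalFilteredColimits.hasColimitsOfShape (κ := kappa) B J
    infer_instance

variable {L R kappa} in
-- The two components of a morphism to a colimit factor separately. Their compatibility holds in the
-- colimit, hence at a later stage because `L.obj x.left` is presentable.
theorem isCardinalPresentable_comma [R.IsCardinalAccessible kappa]
    (hL : ∀ a, isCardinalPresentable A kappa a → isCardinalPresentable T kappa (L.obj a)) :
    presentableComma L R kappa ≤ isCardinalPresentable (Comma L R) kappa := by
  rintro x ⟨hl, hr⟩
  have : IsCardinalPresentable x.left kappa := hl
  have : IsCardinalPresentable x.right kappa := hr
  have : IsCardinalPresentable (L.obj x.left) kappa := hL _ hl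
  refine isCardinalPresentable_of_exists (fun J _ _ D c hc f ↦ ?_)
    fun J _ _ D c hc j f g h ↦ ?_
  · have := isFiltered_of_isCardinalFiltered J kappa
    have := (Comma.fst L R).preservesColimitsOfShape_of_isCardinalAccessible kappa J
    have := (Comma.snd L R).preservesColimitsOfShape_of_isCardinalAccessible kappa J
    have := R.preservesColimitsOfShape_of_isCardinalAccessible kappa J
    have hc₁ := isColimitOfPreserves (Comma.fst L R) hc
    have hc₂ := isColimitOfPreserves (Comma.snd L R) hc
    have hc₃ := isColimitOfPreserves R hc₂
    obtain ⟨j, p, hp⟩ : ∃ (j : J) (p : x.left ⟶ (D.obj j).left), p ≫ (c.ι.app j).left = f.left :=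
      IsCardinalPresentable.exists_hom_of_isColimit kappa hc₁ f.left
    obtain ⟨j', q, hq⟩ : ∃ (j : J) (q : x.right ⟶ (D.obj j).right),
        q ≫ (c.ι.app j).right = f.right :=
      IsCardinalPresentable.exists_hom_of_isColimit kappa hc₂ f.right
    have hw : (L.map p ≫ (D.obj j).hom) ≫ R.map (c.ι.app j).right =
        (x.hom ≫ R.map q) ≫ R.map (c.ι.app j').right := by
      rw [Category.assoc, Category.assoc, ← R.map_comp, hq, ← (c.ι.app j).w, ← f.w, ← hp,
        L.map_comp]
      exact (Category.assoc ..).symm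
    obtain ⟨k, s, t, hst⟩ : ∃ (k : J) (s : j ⟶ k) (t : j' ⟶ k),
        (L.map p ≫ (D.obj j).hom) ≫ R.map (D.map s).right =
          (x.hom ≫ R.map q) ≫ R.map (D.map t).right :=
      IsCardinalPresentable.exists_eq_of_isColimit kappa hc₃ _ _ hw
    let g : x ⟶ D.obj k :=
      { left := p ≫ (D.map s).left
        right := q ≫ (D.map t).right
        w := by
          rw [L.map_comp, R.map_comp, Category.assoc, (D.map s).w, ← Category.assoc, hst,
            Category.assoc] }
    refine ⟨k, g, ?_⟩
    ext
    · refine Eq.trans ?_ hp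
      rw [← c.w s]
      exact Category.assoc ..
    · refine Eq.trans ?_ hq
      rw [← c.w t]
      exact Category.assoc ..
  · have := isFiltered_of_isCardinalFiltered J kappa
    have := (Comma.fst L R).preservesColimitsOfShape_of_isCardinalAccessible kappa J
    have := (Comma.snd L R).preservesColimitsOfShape_of_isCardinalAccessible kappa J
    have hc₁ := isColimitOfPreserves (Comma.fst L R) hc
    have hc₂ := isColimitOfPreserves (Comma.snd L R) hc
    obtain ⟨k, s, hs⟩ : ∃ (k : J) (s : j ⟶ k),
        f.left ≫ (D.map s).left = g.left ≫ (D.map s).left :=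
      IsCardinalPresentable.exists_eq_of_isColimit' kappa hc₁ f.left g.left congr(($h).left)
    obtain ⟨k', t, ht⟩ : ∃ (k' : J) (t : j ⟶ k'),
        f.right ≫ (D.map t).right = g.right ≫ (D.map t).right :=
      IsCardinalPresentable.exists_eq_of_isColimit' kappa hc₂ f.right g.right congr(($h).right)
    obtain ⟨l, a, b, hab⟩ := IsFiltered.span s t
    refine ⟨l, s ≫ a, ?_⟩
    ext
    · have := congr($hs ≫ (D.map a).left)
      simpa using this
    · have := congr($ht ≫ (D.map b).right)
      rw [hab]
      simpa using this

end

variable [L.IsCardinalAccessible kappa] [IsCardinalAccessibleCategory A kappa]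
  [IsCardinalAccessibleCategory B kappa] [R.IsCardinalAccessible kappa]

variable {L R kappa} in
theorem isCardinalFilteredGenerator_presentableComma
    (hL : ∀ a, isCardinalPresentable A kappa a → isCardinalPresentable T kappa (L.obj a)) :
    (presentableComma L R kappa).IsCardinalFilteredGenerator kappa where
  le_isCardinalPresentable := isCardinalPresentable_comma hL
  exists_colimitsOfShape x := by
    obtain ⟨I, _, _, ⟨p⟩⟩ :=
      (isCardinalFilteredGenerator_isCardinalPresentable A kappa).exists_colimitsOfShape x.left
    obtain ⟨J, _, _, ⟨q⟩⟩ :=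
      (isCardinalFilteredGenerator_isCardinalPresentable B kappa).exists_colimitsOfShape x.right
    obtain ⟨I', _, _, F, _⟩ := IsCardinalFiltered.exists_cardinal_directed I kappa
    obtain ⟨J', _, _, G, _⟩ := IsCardinalFiltered.exists_cardinal_directed J kappa
    exact ⟨_, inferInstance, isCardinalFiltered_commaIndex (p.reindex F) (q.reindex G) x.hom hL,
      colimitsOfShape_commaIndex (p.reindex F) (q.reindex G) x.hom hL⟩

variable {L R kappa} in
-- Every presentable object is a retract of a member of the generator, and componentwise
-- presentability is stable under retracts.
theorem presentableComma_eq
    (hL : ∀ a, isCardinalPresentable A kappa a → isCardinalPresentable T kappa (L.obj a)) :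
    isCardinalPresentable (Comma L R) kappa = presentableComma L R kappa := by
  refine le_antisymm ?_ (isCardinalPresentable_comma hL)
  rw [(isCardinalFilteredGenerator_presentableComma hL).isPresentable_eq_retractClosure]
  rintro x ⟨y, hy, ⟨r⟩⟩
  exact ⟨(isCardinalPresentable A kappa).prop_of_retract (r.map (Comma.fst L R)) hy.1,
    (isCardinalPresentable B kappa).prop_of_retract (r.map (Comma.snd L R)) hy.2⟩

variable {L R kappa} in
theorem EssentiallyBelow.isCardinalAccessibleCategory_comma {delta : Cardinal.{w}}
    (hL : ∀ a, isCardinalPresentable A kappa a → isCardinalPresentable T kappa (L.obj a))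
    [LocallySmall.{w} (Comma L R)] (h : EssentiallyBelow (presentableComma L R kappa) delta) :
    IsCardinalAccessibleCategory (Comma L R) kappa :=
  have := h.essentiallySmall
  have := (isCardinalFilteredGenerator_presentableComma (R := R) hL).hasCardinalFilteredGenerator
  { }

end Comma

/-! ### The terminal category, as source of the functor selecting a one-element set. -/

section Point

variable (kappa : Cardinal.{w}) [Fact kappa.IsRegular]

theorem isCardinalPresentable_discretePUnit (X : Discrete PUnit.{1}) :
    isCardinalPresentable (Discrete PUnit.{1}) kappa X :=
  isCardinalPresentable_of_exists
    (fun J _ _ _ _ _ _ ↦ ⟨(IsCardinalFiltered.nonempty J kappa).some, eqToHom (by ext),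
      Subsingleton.elim _ _⟩)
    fun _ _ _ _ _ _ j _ _ _ ↦ ⟨j, 𝟙 _, Subsingleton.elim _ _⟩

theorem essentiallyBelow_discretePUnit {delta : Cardinal.{w}} (hd : Cardinal.aleph0 ≤ delta)
    (P : ObjectProperty (Discrete PUnit.{1})) : EssentiallyBelow P delta :=
  ⟨PUnit, fun _ ↦ ⟨⟨⟩⟩, hasCardinalLT_of_finite _ _ hd, fun _ _ ↦ ⟨⟨⟩, ⟨Iso.refl _⟩⟩,
    fun _ _ ↦ hasCardinalLT_of_finite _ _ hd⟩

instance isCardinalAccessibleCategory_discretePUnit :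
    IsCardinalAccessibleCategory (Discrete PUnit.{1}) kappa :=
  have h0 := (Fact.out : kappa.IsRegular).aleph0_le
  have h : (isCardinalPresentable (Discrete PUnit.{1}) kappa).IsCardinalFilteredGenerator kappa :=
    { le_isCardinalPresentable := le_rfl
      exists_colimitsOfShape X := ⟨PUnit, inferInstance, isCardinalFiltered_preorder _ _
        fun _ _ _ ↦ ⟨⟨⟩, fun _ ↦ le_rfl⟩,
        ⟨⟨.self X, fun _ ↦ isCardinalPresentable_discretePUnit kappa _⟩⟩⟩ }
  have := (essentiallyBelow_discretePUnit h0
    (isCardinalPresentable (Discrete PUnit.{1}) kappa)).essentiallySmall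
  have := h.hasCardinalFilteredGenerator
  { hasColimitsOfShape J _ _ := ⟨fun F ↦ ⟨⟨⟨⟨⟨⟨⟩⟩, ⟨fun _ ↦ eqToHom (by ext), fun _ _ _ ↦
      Subsingleton.elim _ _⟩⟩, ⟨fun _ ↦ eqToHom (by ext), fun _ _ ↦ Subsingleton.elim _ _,
      fun _ _ _ ↦ Subsingleton.elim _ _⟩⟩⟩⟩⟩ }

end Point

/-! ### Pointed spans, amalgams and equivalence of types. -/

section Spans

variable {K : Type (w + 1)} [Category.{w} K] (U : K ⥤ Type w)

/-- The objects `N` of `K` with a point of `U.obj N`. -/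
abbrev PointedObj : Type (w + 1) := Comma (Functor.fromPUnit.{0} PUnit.{w + 1}) U

/-- The underlying object of a pointed object. -/
abbrev underlying : PointedObj U ⥤ K := Comma.snd _ _

/-- The morphisms of `K` with a point of the target. -/
abbrev PointedArrow : Type (w + 1) := Comma (𝟭 K) (underlying U)

/-- The spans in `K` with a point of each of the two targets. -/
abbrev PointedSpan : Type (w + 1) := Comma (Comma.fst (𝟭 K) (underlying U)) (underlying U)

/-- The span of identities of a pointed object. -/
def identitySpan : PointedObj U ⥤ PointedSpan U where
  obj e :=
    { left := { left := e.right, right := e, hom := 𝟙 e.right }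
      right := e
      hom := 𝟙 e.right }
  map f :=
    { left :=
        { left := f.right
          right := f
          w := (Category.comp_id _).trans (Category.id_comp _).symm }
      right := f
      w := (Category.comp_id _).trans (Category.id_comp _).symm }

/-- The pointed spans with an amalgam, that is, a morphism to a span of identities. -/
abbrev AmalgamatedSpan : Type (w + 1) := Comma (𝟭 (PointedSpan U)) (identitySpan U)

variable {U} in
/-- The pointed object given by an element. -/
abbrev PointedObj.mk {N : K} (a : U.obj N) : PointedObj U :=
  { left := ⟨⟨⟩⟩, right := N, hom := ↾fun _ ↦ a }

variable {U} in
/-- The pointed span given by two morphisms and two elements. -/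
abbrev PointedSpan.mk {M N₁ N₂ : K} (f₁ : M ⟶ N₁) (a₁ : U.obj N₁) (f₂ : M ⟶ N₂) (a₂ : U.obj N₂) :
    PointedSpan U :=
  { left := { left := M, right := PointedObj.mk a₁, hom := f₁ }
    right := PointedObj.mk a₂
    hom := f₂ }

variable {U} in
-- A morphism to an identity span consists of `g₁` and `g₂` into one object, sending both elements
-- to its point; its component on `M` is forced to be both `f₁ ≫ g₁` and `f₂ ≫ g₂`.
theorem typeEquiv_iff_nonempty_hom {M N₁ N₂ : K} (f₁ : M ⟶ N₁) (a₁ : U.obj N₁) (f₂ : M ⟶ N₂)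
    (a₂ : U.obj N₂) : TypeEquiv U f₁ a₁ f₂ a₂ ↔
      ∃ e : PointedObj U, Nonempty (PointedSpan.mk f₁ a₁ f₂ a₂ ⟶ (identitySpan U).obj e) := by
  constructor
  · rintro ⟨N, g₁, g₂, hg, ha⟩
    refine ⟨PointedObj.mk (U.map g₁ a₁), ⟨
      { left :=
          { left := f₁ ≫ g₁
            right := { left := 𝟙 _, right := g₁, w := ?_ }
            w := ?_ }
        right := { left := 𝟙 _, right := g₂, w := ?_ }
        w := ?_ }⟩⟩
    · rfl
    · exact Category.comp_id _
    · ext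
      exact ha
    · exact (Category.comp_id _).trans hg
  · rintro ⟨e, ⟨φ⟩⟩
    have w₁ : f₁ ≫ φ.left.right.right = φ.left.left :=
      φ.left.w.symm.trans (Category.comp_id _)
    have w₂ : f₂ ≫ φ.right.right = φ.left.left := φ.w.symm.trans (Category.comp_id _)
    refine ⟨e.right, φ.left.right.right, φ.right.right, w₁.trans w₂.symm, ?_⟩
    exact (ConcreteCategory.congr_hom φ.left.right.w PUnit.unit).symm.trans
      (ConcreteCategory.congr_hom φ.right.w PUnit.unit)

/-- Having an amalgam is inherited along any morphism into an amalgamated span, so the monomorphism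
plays no role; conversely the identity is one. -/
theorem powerfulImage_fst_iff (x : PointedSpan U) :
    powerfulImage (Comma.fst (𝟭 (PointedSpan U)) (identitySpan U)) x ↔
      ∃ e : PointedObj U, Nonempty (x ⟶ (identitySpan U).obj e) := by
  constructor
  · rintro ⟨A, m, -⟩
    exact ⟨A.right, ⟨m ≫ A.hom⟩⟩
  · rintro ⟨e, ⟨φ⟩⟩
    exact ⟨{ left := x, right := e, hom := φ }, 𝟙 x, inferInstance⟩

variable {U} in
theorem powerfulImage_fst_mk_iff {M N₁ N₂ : K} (f₁ : M ⟶ N₁) (a₁ : U.obj N₁) (f₂ : M ⟶ N₂)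
    (a₂ : U.obj N₂) :
    powerfulImage (Comma.fst (𝟭 (PointedSpan U)) (identitySpan U)) (PointedSpan.mk f₁ a₁ f₂ a₂) ↔
      TypeEquiv U f₁ a₁ f₂ a₂ := by
  rw [powerfulImage_fst_iff, typeEquiv_iff_nonempty_hom]

section

variable {U} {I : Type w} [PartialOrder I] {G : I ⥤ K} (c : Cocone G) {N₁ N₂ : K}
  (f₁ : c.pt ⟶ N₁) (a₁ : U.obj N₁) (f₂ : c.pt ⟶ N₂) (a₂ : U.obj N₂)

/-- The diagram of pointed spans with fixed targets induced by a cocone. -/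
abbrev spanDiagram : I ⥤ PointedSpan U where
  obj i := PointedSpan.mk (c.ι.app i ≫ f₁) a₁ (c.ι.app i ≫ f₂) a₂
  map {i j} s :=
    { left :=
        { left := G.map s
          right := 𝟙 (PointedObj.mk a₁)
          w := ((Category.assoc ..).symm.trans congr($(c.w s) ≫ f₁)).trans
            (Category.comp_id _).symm }
      right := 𝟙 (PointedObj.mk a₂)
      w := ((Category.assoc ..).symm.trans congr($(c.w s) ≫ f₂)).trans (Category.comp_id _).symm }
  map_id i := by
    ext <;> simp
  map_comp s t := by
    ext <;> simp

/-- The cocone of pointed spans with fixed targets induced by a cocone. -/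
abbrev spanCocone : Cocone (spanDiagram c f₁ a₁ f₂ a₂) where
  pt := PointedSpan.mk f₁ a₁ f₂ a₂
  ι :=
    { app i :=
        { left :=
            { left := c.ι.app i
              right := 𝟙 (PointedObj.mk a₁)
              w := (Category.comp_id _).symm }
          right := 𝟙 (PointedObj.mk a₂)
          w := (Category.comp_id _).symm }
      naturality i j s := by
        ext <;> simp }

variable {c} in
/-- A colimit of sources is a colimit of pointed spans with fixed targets. -/
def isColimitSpanCocone [IsConnected I] (hc : IsColimit c) :
    IsColimit (spanCocone c f₁ a₁ f₂ a₂) :=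
  have h : IsColimit ((Comma.fst _ _).mapCocone (spanCocone c f₁ a₁ f₂ a₂)) := by
    refine Comma.fstSndJointlyReflectColimit hc ?_
    -- Connectedness of `I` makes the fixed target the colimit of its constant diagram.
    exact isColimitConstCocone I (PointedObj.mk a₁)
  have : PreservesColimit (spanDiagram c f₁ a₁ f₂ a₂ ⋙ Comma.fst _ _)
      (Comma.fst (𝟭 K) (underlying U)) :=
    preservesColimit_of_preserves_colimit_cocone h hc
  Comma.fstSndJointlyReflectColimit h (isColimitConstCocone I (PointedObj.mk a₂))

end

end Spans

/-! ### The forgetful functor from amalgamated spans is below `delta`. -/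

section Accessibility

variable {K : Type (w + 1)} [Category.{w} K] {U : K ⥤ Type w} {kappa : Cardinal.{w}}
  [Fact kappa.IsRegular]

instance isCardinalAccessible_fromPUnit {T : Type u} [Category.{v} T] (X : T) :
    (Functor.fromPUnit.{0} X).IsCardinalAccessible kappa where
  preservesColimitOfShape J _ _ := ⟨fun {_} ↦ ⟨fun {c} _ ↦ ⟨by
    have h := isFiltered_of_isCardinalFiltered J kappa
    have (j : J) : IsIso (((Functor.fromPUnit.{0} X).mapCocone c).ι.app j) :=
      inferInstanceAs (IsIso (𝟙 X))
    exact Functor.IsEventuallyConstantFrom.isColimitOfIsIso (i₀ := h.nonempty.some)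
      (fun _ _ ↦ inferInstanceAs (IsIso (𝟙 X))) _⟩⟩⟩

/-- Each component of the identity span is the pointed object or its underlying object, and colimits
of spans are detected on components. -/
instance isCardinalAccessible_identitySpan [HasCardinalFilteredColimits.{w} K kappa] :
    (identitySpan U).IsCardinalAccessible kappa where
  preservesColimitOfShape J _ _ := ⟨fun {D} ↦ ⟨fun {c} hc ↦ ⟨by
    have := (underlying U).preservesColimitsOfShape_of_isCardinalAccessible kappa J
    have := (Comma.fst (𝟭 K) (underlying U)).preservesColimitsOfShape_of_isCardinalAccessible
      kappa J
    exact Comma.fstSndJointlyReflectColimit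
      (Comma.fstSndJointlyReflectColimit (isColimitOfPreserves (underlying U) hc) hc) hc⟩⟩⟩

variable [IsCardinalAccessibleCategory K kappa] [U.IsCardinalAccessible kappa]

theorem isCardinalPresentable_fromPUnit_obj (a : Discrete PUnit.{1})
    (_ : isCardinalPresentable (Discrete PUnit.{1}) kappa a) :
    isCardinalPresentable (Type w) kappa ((Functor.fromPUnit.{0} PUnit.{w + 1}).obj a) :=
  (hasCardinalLT_of_finite PUnit kappa (Fact.out : kappa.IsRegular).aleph0_le).isCardinalPresentable

variable (U) in
/-- The powerful image of the forgetful functor from amalgamated spans is closed under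
`nu`-small `mu`-directed colimits as soon as powerful images of functors below `delta` are. -/
theorem closedUnderSmallDirectedColimits_fst {delta mu nu : Cardinal.{w}}
    (hd : delta.IsInaccessible) (hk : kappa < delta)
    (hK : EssentiallyBelow (isCardinalPresentable K kappa) delta)
    (hU : ∀ X, isCardinalPresentable K kappa X → isCardinalPresentable (Type w) kappa (U.obj X))
    (hclosed : ∀ (A B : Type (w + 1)) [Category.{w} A] [Category.{w} B] (F : A ⥤ B),
      CategoryBelow A delta → FunctorBelow F delta →
        ClosedUnderSmallDirectedColimits (powerfulImage F) nu mu) :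
    ClosedUnderSmallDirectedColimits
      (powerfulImage (Comma.fst (𝟭 (PointedSpan U)) (identitySpan U))) nu mu := by
  have hobj : EssentiallyBelow (presentableComma (Functor.fromPUnit.{0} PUnit.{w + 1}) U kappa)
      delta := by
    refine essentiallyBelow_presentableComma hd.isRegular
      (essentiallyBelow_discretePUnit hd.aleph0_lt.le _) hK fun _ b _ hb ↦ ?_
    -- Preservation of presentable objects by `U` is what bounds the number of points.
    have : HasCardinalLT (U.obj b) kappa := (Types.isCardinalPresentable_iff kappa).1 (hU b hb)
    refine (this.of_le hk.le).of_injective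
      (fun f : PUnit.{w + 1} ⟶ U.obj b ↦ f PUnit.unit) fun f g hfg ↦ ?_
    ext
    exact hfg
  have eobj := presentableComma_eq (R := U) (isCardinalPresentable_fromPUnit_obj (kappa := kappa))
  have : IsCardinalAccessibleCategory (PointedObj U) kappa :=
    hobj.isCardinalAccessibleCategory_comma isCardinalPresentable_fromPUnit_obj
  rw [← eobj] at hobj
  have hund (e : PointedObj U) (he : isCardinalPresentable _ kappa e) :
      isCardinalPresentable K kappa e.right := (eobj.le e he).2
  have harr : EssentiallyBelow (presentableComma (𝟭 K) (underlying U) kappa) delta :=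
    essentiallyBelow_presentableComma hd.isRegular hK hobj fun _ b ha hb ↦ hK.hom_lt ha (hund b hb)
  have earr := presentableComma_eq (L := 𝟭 K) (R := underlying U) (kappa := kappa) fun _ h ↦ h
  have : IsCardinalAccessibleCategory (PointedArrow U) kappa :=
    harr.isCardinalAccessibleCategory_comma fun _ h ↦ h
  rw [← earr] at harr
  have hfst (e : PointedArrow U) (he : isCardinalPresentable _ kappa e) :
      isCardinalPresentable K kappa e.left := (earr.le e he).1
  have hspan : EssentiallyBelow
      (presentableComma (Comma.fst (𝟭 K) (underlying U)) (underlying U) kappa) delta :=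
    essentiallyBelow_presentableComma hd.isRegular harr hobj
      fun a b ha hb ↦ hK.hom_lt (hfst a ha) (hund b hb)
  have espan := presentableComma_eq (L := Comma.fst (𝟭 K) (underlying U)) (R := underlying U) hfst
  have : IsCardinalAccessibleCategory (PointedSpan U) kappa :=
    hspan.isCardinalAccessibleCategory_comma hfst
  rw [← espan] at hspan
  have hid (e : PointedObj U) (he : isCardinalPresentable _ kappa e) :
      isCardinalPresentable (PointedSpan U) kappa ((identitySpan U).obj e) := by
    rw [espan]
    refine ⟨?_, he⟩
    rw [earr]
    exact ⟨hund e he, he⟩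
  have ham : EssentiallyBelow (presentableComma (𝟭 (PointedSpan U)) (identitySpan U) kappa) delta :=
    essentiallyBelow_presentableComma hd.isRegular hspan hobj
      fun a b ha hb ↦ hspan.hom_lt ha (hid b hb)
  have eam := presentableComma_eq (L := 𝟭 (PointedSpan U)) (R := identitySpan U) (kappa := kappa)
    fun _ h ↦ h
  have : IsCardinalAccessibleCategory (AmalgamatedSpan U) kappa :=
    ham.isCardinalAccessibleCategory_comma fun _ h ↦ h
  rw [← eam] at ham
  exact hclosed _ _ _ (ham.categoryBelow hd hk)
    (functorBelow_of_preserves hd hspan hk _ fun x hx ↦ (eam.le x hx).1)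

end Accessibility

/-- In a `kappa`-accessible category every `nu`-presentable object is a retract of a `nu`-small
`mu`-directed colimit of `mu`-presentable objects if `kappa` is sharply smaller than `mu` and `mu`
is sharply smaller than or equal to `nu`. -/
theorem exists_retract_of_sharplyLT_of_sharplyLE {C : Type u} [Category.{w} C]
    {kappa mu nu : Cardinal.{w}} [Fact kappa.IsRegular] [Fact mu.IsRegular] [Fact nu.IsRegular]
    [IsCardinalAccessibleCategory C kappa] (h : SharplyLT kappa mu) (h' : SharplyLE mu nu)
    {X : C} (hX : isCardinalPresentable C nu X) :
    ∃ Y, smallDirectedColimits (isCardinalPresentable C mu) mu nu Y ∧ Nonempty (Retract X Y) := by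
  have : IsCardinalPresentable X nu := hX
  have : HasCardinalFilteredColimits.{w} C mu :=
    ⟨fun J _ _ ↦
      have := IsCardinalFiltered.of_le J h.lt.le
      HasCardinalFilteredColimits.hasColimitsOfShape (κ := kappa) C J⟩
  obtain ⟨J, _, _, hJ⟩ :=
    (isCardinalFilteredGenerator_isCardinalPresentable C kappa).exists_colimitsOfShape X
  -- The first sharp inequality makes `X` a `mu`-directed colimit of `mu`-presentable objects; the
  -- second then yields the retract.
  obtain ⟨S, _, _, hS⟩ := h.exists_colimitsOfShape hJ
  exact h'.exists_retract (ObjectProperty.colimitsOfShape_monotone S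
    (smallDirectedColimits_le_isCardinalPresentable le_rfl h.lt.le) _ hS)

end AccTame

end

theorem theorem3p4 (delta kappa theta : Cardinal.{w})
    (hdelta : delta.IsInaccessible) (hkappa : kappa.IsInaccessible) (hle : delta ≤ kappa)
    (htheta : AccTame.SharplyLE kappa (Order.succ theta))
    (hclosed : ∀ (A B : Type (w + 1)) [CategoryTheory.Category.{w} A]
      [CategoryTheory.Category.{w} B] (F : A ⥤ B),
        AccTame.CategoryBelow A delta → AccTame.FunctorBelow F delta →
        AccTame.ClosedUnderSmallDirectedColimits (AccTame.powerfulImage F)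
          (Order.succ theta) kappa)
    (K : Type (w + 1)) [CategoryTheory.Category.{w} K] (U : K ⥤ Type w)
    (lam : Cardinal.{w}) (hlam : lam < delta) (hK : AccTame.ConcretelyAccessible U lam)
    (hKbelow : AccTame.CategoryBelow K delta) :
    AccTame.Tame U kappa theta := by
  obtain ⟨hreg, hKacc, -, hUacc⟩ := hK.accessibleFunctor
  have hKbd := hKbelow.essentiallyBelow hdelta hlam
  have hcl := AccTame.closedUnderSmallDirectedColimits_fst U hdelta hlam hKbd
    (fun X hX ↦ (hK.preservesPresentable X ⟨hreg, hX⟩).2) hclosed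
  have : Fact kappa.IsRegular := ⟨hkappa.isRegular⟩
  rintro M ⟨hreg', hM⟩ N₁ N₂ f₁ a₁ f₂ a₂ h
  obtain ⟨Y, ⟨I, _, _, hI, ⟨p⟩⟩, ⟨r⟩⟩ := AccTame.exists_retract_of_sharplyLT_of_sharplyLE
    (AccTame.sharplyLT_of_isInaccessible hreg.out hkappa (hlam.trans_le hle)) htheta hM
  have := isFiltered_of_isCardinalFiltered I kappa
  have := IsFiltered.isConnected I
  -- The colimit has `M` only as a retract, so the span is pulled back along `r.r` before closure is
  -- applied.
  have key := hcl I ((AccTame.isCardinalFiltered_iff_directedPoset I kappa).1 inferInstance)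
    ((hasCardinalLT_iff_cardinal_mk_lt _ _).1 hI)
    (AccTame.spanDiagram p.cocone (r.r ≫ f₁) a₁ (r.r ≫ f₂) a₂) (fun i ↦ ?_) _
    ⟨AccTame.isColimitSpanCocone _ a₁ _ a₂ p.isColimit⟩
  · obtain ⟨N, g₁, g₂, hg, ha⟩ := (AccTame.powerfulImage_fst_mk_iff _ a₁ _ a₂).1 key
    -- The targets and elements never changed, so the same amalgam works over `M` after
    -- precomposition with the section.
    exact ⟨N, g₁, g₂, by simpa using congr(r.i ≫ $hg), ha⟩
  · rw [AccTame.powerfulImage_fst_mk_iff]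
    simpa using h (p.diag.obj i) (p.ι.app i ≫ r.r) ⟨inferInstance, p.prop_diag_obj i⟩
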